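/- Logarithms are to base $2$. In the game MaxNCG with $n$ players and edge price $\alpha>0$, each player $u\in V$ chooses a set $\sigma_u\subseteq V\setminus\{u\}$ of edges to buy. The network $G(\sigma)$ has vertex set $V$ and edge set $\{\{u,v\} : v\in\sigma_u\}$, and the cost of $u$ is $C_u(\sigma)=\alpha|\sigma_u|+\max_{v\in V}d_{G(\sigma)}(u,v)$ (infinite if $G(\sigma)$ is disconnected). The social cost of $\sigma$ is $\sum_{u}C_u(\sigma)$. Fix an integer view radius $k$. The view of $u$ in $\sigma$ is the subgraph of $G(\sigma)$ induced by the vertices at distance at most $k$ from $u$. When $u$ considers switching to a strategy $\sigma_u'$ (a set of vertices of her view, not containing $u$), the worst possible cost difference $\Delta(\sigma_u,\sigma_u')$ is the supremum of $C_u(\tau_{-u},\sigma_u')-C_u(\tau)$ over all profiles $\tau$ of finitely many (arbitrarily many) players such that $\tau_u=\sigma_u$, $G(\tau)$ is connected, and the view of $u$ in $\tau$ is the same graph as her view in $\sigma$. The profile $\sigma$ is a Local Knowledge Equilibrium (LKE) if $\Delta(\sigma_u,\sigma_u')\ge 0$ for every player $u$ and every such $\sigma_u'$. The price of anarchy $\mathrm{PoA}(n,\alpha,k)$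 is the maximum social cost of an LKE on $n$ players whose network is connected, divided by the minimum social cost of a profile on $n$ players. Theorem. There is an absolute constant $c>0$ such that for all integers $n,k\ge 1$ and all real $\alpha$ with $1<\alpha\le k\le 2^{\sqrt{\log n}-3}$, writing $\ell=\lceil\alpha\rceil$, $$\mathrm{PoA}(n,\alpha,k)\;\ge\; c\cdot\frac{n}{\alpha\cdot 2^{\left(\log\frac{k}{\ell}+3\right)\log\frac{k}{\ell}}}.$$ -/

import Mathlib

open scoped ENNReal

noncomputable section

namespace MaxNCG

/-- A strategy profile of the players `V`: player `u` buys a finite set of edges, given by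
their other endpoints, which are players different from `u`. -/
abbrev Profile (V : Type) : Type := (u : V) → {S : Finset V // u ∉ S}

variable {V : Type}

/-- The undirected network `G(σ)` created by the profile `σ`. -/
def network (σ : Profile V) : SimpleGraph V where
  Adj u v := v ∈ (σ u).1 ∨ u ∈ (σ v).1
  symm := ⟨fun _ _ h => h.symm⟩
  loopless := ⟨fun u h => h.elim (σ u).2 (σ u).2⟩

open Classical in
/-- The profile `(σ_{-u}, S)`: player `u` switches to the strategy `S`. -/
def deviate (σ : Profile V) (u : V) (S : {S : Finset V // u ∉ S}) : Profile V :=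
  Function.update σ u S

/-- The cost `C_u(σ) = α |σ_u| + max_v d_{G(σ)}(u, v)`; it is `∞` if some player cannot be
reached from `u`. -/
def cost (α : ℝ) (σ : Profile V) (u : V) : ℝ≥0∞ :=
  ENNReal.ofReal α * ((σ u).1.card : ℝ≥0∞) + ((network σ).eccent u : ℝ≥0∞)

/-- The social cost of a profile: the sum of the costs of all players. -/
def socialCost [Fintype V] (α : ℝ) (σ : Profile V) : ℝ≥0∞ := ∑ u, cost α σ u

/-- The `k`-neighborhood of `u` in `G`. -/
def ball (G : SimpleGraph V) (k : ℕ) (u : V) : Set V := {v | G.edist u v ≤ k}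

/-- The centre of a `k`-neighborhood, as one of its elements. -/
def centre (G : SimpleGraph V) (k : ℕ) (u : V) : ball G k u := ⟨u, by simp [ball]⟩

/-- The view of player `u`: the subgraph of the network induced by her `k`-neighborhood. -/
def view (k : ℕ) (σ : Profile V) (u : V) : SimpleGraph (ball (network σ) k u) :=
  (network σ).induce (ball (network σ) k u)

/-- A situation that player `u` has to consider possible: a profile of finitely many players
(of any number, since `u` does not know how many there are) whose network is connected, in which
the view of `u` is the one she has in `σ`, and in which she plays the strategy that she plays in
`σ`. The map `emb` identifies the nodes seen by `u` with players of the other network. -/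
structure Realization (k : ℕ) (σ : Profile V) (u : V) where
  Player : Type
  finite : Finite Player
  profile : Profile Player
  connected : (network profile).Connected
  emb : view k σ u ↪g network profile
  range_emb : Set.range emb = ball (network profile) k (emb (centre (network σ) k u))
  same_strategy : ∀ y : Player, y ∈ (profile (emb (centre (network σ) k u))).1 ↔
    ∃ x : ball (network σ) k u, x.1 ∈ (σ u).1 ∧ emb x = y

namespace Realization

variable {k : ℕ} {σ : Profile V} {u : V}

/-- The player of the realization that plays the role of `u`. -/
def self (R : Realization k σ u) : R.Player := R.emb (centre (network σ) k u)

/-- A set of nodes seen by `u`, not containing `u`, read as a strategy in the realization. -/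
def transport (R : Realization k σ u)
    (S : {S : Finset (ball (network σ) k u) // centre (network σ) k u ∉ S}) :
    {T : Finset R.Player // R.self ∉ T} :=
  ⟨S.1.map R.emb.toEmbedding, fun h => by
    obtain ⟨x, hx, hxu⟩ := Finset.mem_map.1 h
    exact S.2 (R.emb.injective hxu ▸ hx)⟩

end Realization

/-- The worst possible cost difference, over all realizable situations, that player `u` faces
when she switches from `σ u` to the strategy `S`, a set of nodes in her `k`-neighborhood. The
subtrahend is always finite because realizations are finite and connected. -/
def worstDifference (α : ℝ) (k : ℕ) (σ : Profile V) (u : V)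
    (S : {S : Finset (ball (network σ) k u) // centre (network σ) k u ∉ S}) : EReal :=
  ⨆ R : Realization k σ u,
    ((cost α (deviate R.profile R.self (R.transport S)) R.self : ℝ≥0∞) : EReal)
      - ((cost α R.profile R.self : ℝ≥0∞) : EReal)

/-- Local Knowledge Equilibrium with view radius `k`. -/
def IsLKE (α : ℝ) (k : ℕ) (σ : Profile V) : Prop :=
  ∀ (u : V) (S : {S : Finset (ball (network σ) k u) // centre (network σ) k u ∉ S}),
    0 ≤ worstDifference α k σ u S

/-- The price of anarchy of the game with `n` players: the largest social cost of a Local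
Knowledge Equilibrium with a connected network, divided by the optimal social cost. -/
def priceOfAnarchy (n : ℕ) (α : ℝ) (k : ℕ) : ℝ≥0∞ :=
  (⨆ (σ : Profile (Fin n)) (_ : (network σ).Connected ∧ IsLKE α k σ), socialCost α σ) /
    (⨅ σ : Profile (Fin n), socialCost α σ)

end MaxNCG

end

open scoped ENNReal

noncomputable section

/-! The bound comes from an equilibrium of large diameter. Its network is a `d`-dimensional torus
with even and odd intersections, joined along all `2 ^ d` diagonals by paths of length `l = ⌈α⌉`.
One side is as long as `n` permits; the others are just long enough that a view of radius `k` does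
not see them close up. Leaves at `odd 0` pad the number of nodes to exactly `n`. Each coordinate,
taken in `ℤ/2lδ i`, changes by at most one along an edge, which bounds distances from below;
straight diagonal lines are paths, which bounds them from above.

Why this is an equilibrium: a player cannot exclude that a long path hangs at a node `x` at distance
exactly `k`, and then any change of her distance to `x` is a change of her eccentricity. So a
deviation `S` is harmless once some such `x` satisfies `α|σ u| + k ≤ α|S| + N`, where `N` bounds the
new distance to `x` from below (`Robust`, `isLKE_of_robust`). The candidates for `x` are `2 ^ d`
corners at distance `k` that are far from one another, so that a single bought edge cannot bring two
of them close. Buying more edges: either some corner comes closer by at most `l - 1 ≤ α`, which one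
extra edge already costs, or every corner needs its own edge, which is too expensive since `2 ^ d`
is of order `k / l` (`unprofitable_of_card_lt`). Buying equally many: a suitable set of corners
outnumbers the edges, so one of them stays at distance at least `k` (`unprofitable_of_card_eq`).
Buying fewer: an owner that nobody else links to is cut off if she drops everything; otherwise an
inner node of a path drops one edge and some corner recedes to distance `k + l`, which outweighs the
saved `α` (`robust_inner_of_pos`, `robust_inner_zero`).

With `q = k / l`, sides of length about `2q` and `d` about `log (2q)`, a slice of the torus has `2 ^
((log q + 3) log q) * l` nodes up to a constant. The long side, and with it every eccentricity, is
therefore of order `n / 2 ^ ((log q + 3) log q)`, whereas a star costs only `3nα` in total. -/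

namespace MaxNCG

/-! ### Distances after a deviation, and situations with a tail attached -/

section Generic

variable {V : Type}

/-- A function that grows by at most one along every edge bounds distances from below. -/
theorem le_edist_of_potential (G : SimpleGraph V) (φ : V → ℤ)
    (h : ∀ v w, G.Adj v w → φ w ≤ φ v + 1) (u x : V) (N : ℕ) (hN : (N : ℤ) ≤ φ x - φ u) :
    (N : ℕ∞) ≤ G.edist u x := by
  have key : ∀ (a b : V) (p : G.Walk a b), φ b - φ a ≤ p.length := by
    intro a b p
    induction p with
    | nil => simp
    | cons hadj p ih =>
      have := h _ _ hadj
      rw [SimpleGraph.Walk.length_cons]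
      push_cast
      linarith
  refine le_iInf fun p => ?_
  have := key u x p
  exact_mod_cast (by omega : N ≤ p.length)

theorem edist_triangle_le {G : SimpleGraph V} {u v w : V} {a b : ℕ} (h1 : G.edist u v ≤ a)
    (h2 : G.edist v w ≤ b) : G.edist u w ≤ ((a + b : ℕ) : ℕ∞) := by
  push_cast
  exact SimpleGraph.edist_triangle.trans (add_le_add h1 h2)

theorem edist_le_one_of_adj {G : SimpleGraph V} {u v : V} (h : G.Adj u v) :
    G.edist u v ≤ ((1 : ℕ) : ℕ∞) := by
  rw [Nat.cast_one]
  exact (SimpleGraph.edist_eq_one_iff_adj.2 h).le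

theorem deviate_self (σ : Profile V) (u : V) (S : {S : Finset V // u ∉ S}) :
    deviate σ u S u = S := by
  simp [deviate]

theorem deviate_of_ne (σ : Profile V) (u : V) (S : {S : Finset V // u ∉ S}) {v : V}
    (h : v ≠ u) : deviate σ u S v = σ v := by
  simp [deviate, h]

theorem adj_of_adj_deviate {σ : Profile V} {u : V} {S : {S : Finset V // u ∉ S}} {v w : V}
    (h : (network (deviate σ u S)).Adj v w) (hv : v ≠ u) (hw : w ≠ u) :
    (network σ).Adj v w := by
  simpa [network, deviate_of_ne σ u S hv, deviate_of_ne σ u S hw] using h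

theorem adj_deviate_self {σ : Profile V} {u : V} {S : {S : Finset V // u ∉ S}} {w : V}
    (h : (network (deviate σ u S)).Adj u w) : w ∈ S.1 ∨ u ∈ (σ w).1 := by
  have hw : w ≠ u := h.ne'
  simpa [network, deviate_self, deviate_of_ne σ u S hw] using h

/-- A new path that is shorter than the old distance starts with a newly bought edge. -/
theorem exists_bought_of_edist_deviate_le {σ : Profile V} {u : V} {S : {S : Finset V // u ∉ S}}
    {x : V} {T : ℕ} (hT : (network (deviate σ u S)).edist u x ≤ T)
    (hlt : (T : ℕ∞) < (network σ).edist u x) :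
    ∃ s ∈ S.1, ∃ m : ℕ, m + 1 ≤ T ∧ (network σ).edist s x ≤ m := by
  classical
  have hne : (network (deviate σ u S)).edist u x ≠ ⊤ :=
    ne_top_of_le_ne_top (ENat.natCast_ne_top T) hT
  obtain ⟨p, hp⟩ := SimpleGraph.exists_walk_of_edist_ne_top hne
  have hlen : p.bypass.length ≤ T := by
    refine p.length_bypass_le_length.trans ?_
    rw [← hp] at hT
    exact_mod_cast hT
  have hpath := p.bypass_isPath
  generalize p.bypass = q at hlen hpath
  cases q with
  | nil => simp at hlt
  | @cons _ a _ hadj q =>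
    rw [SimpleGraph.Walk.cons_isPath_iff] at hpath
    rw [SimpleGraph.Walk.length_cons] at hlen
    have hd : (network σ).edist a x ≤ q.length := by
      have hedge : ∀ e ∈ q.edges, e ∈ (network σ).edgeSet := by
        intro e he
        induction e with
        | h v w =>
          have h1 := q.fst_mem_support_of_mem_edges he
          have h2 := q.snd_mem_support_of_mem_edges he
          have h3 : (network (deviate σ u S)).Adj v w := q.adj_of_mem_edges he
          exact adj_of_adj_deviate h3 (fun h => hpath.2 (h ▸ h1)) (fun h => hpath.2 (h ▸ h2))
      simpa using SimpleGraph.edist_le (q.transfer _ hedge)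
    rcases adj_deviate_self hadj with h | h
    · exact ⟨a, h, q.length, hlen, hd⟩
    · exfalso
      have h1 : (network σ).Adj u a := Or.inr h
      have h2 := edist_triangle_le (edist_le_one_of_adj h1) hd
      have h3 := hlt.trans_le h2
      have : T < 1 + q.length := by exact_mod_cast h3
      omega

/-- If a deviation brings pairwise distant nodes close, it buys at least as many edges. -/
theorem card_le_of_edist_deviate_le {σ : Profile V} {u : V} {S : {S : Finset V // u ∉ S}}
    {ι : Type} (C : Finset ι) (x : ι → V) {T : ℕ}
    (hT : ∀ c ∈ C, (network (deviate σ u S)).edist u (x c) ≤ T)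
    (hlt : ∀ c ∈ C, (T : ℕ∞) < (network σ).edist u (x c))
    (hsep : ∀ c ∈ C, ∀ c' ∈ C, c ≠ c' → ((2 * T : ℕ) : ℕ∞) ≤ (network σ).edist (x c) (x c')) :
    C.card ≤ S.1.card := by
  classical
  have hex : ∀ c ∈ C, ∃ s ∈ S.1, ∃ m : ℕ, m + 1 ≤ T ∧ (network σ).edist s (x c) ≤ m :=
    fun c hc => exists_bought_of_edist_deviate_le (hT c hc) (hlt c hc)
  choose s hs m hm hd using fun c : C => hex c.1 c.2
  rw [← Finset.card_attach (s := C)]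
  refine Finset.card_le_card_of_injOn s (fun c _ => hs c) fun c _ c' _ hcc => ?_
  by_contra hne
  have h1 := hd c
  rw [SimpleGraph.edist_comm] at h1
  have h2 := hd c'
  rw [← hcc] at h2
  have h3 := (hsep c c.2 c' c'.2 fun h => hne (Subtype.ext h)).trans (edist_triangle_le h1 h2)
  have h4 : 2 * T ≤ m c + m c' := by exact_mod_cast h3
  have := hm c
  have := hm c'
  omega

/-- The profile `σ` with a path of `T + 1` further players attached to the node `x`. -/
def withTail (σ : Profile V) (x : V) (T : ℕ) : Profile (V ⊕ Fin (T + 1))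
  | Sum.inl v => ⟨(σ v).1.map Function.Embedding.inl, by simpa using (σ v).2⟩
  | Sum.inr i => ⟨{Fin.cases (Sum.inl x) (fun j => Sum.inr j.castSucc) i}, by
      cases i using Fin.cases with
      | zero => simp
      | succ j => simp [Fin.ext_iff]⟩

theorem withTail_adj_inl {σ : Profile V} {x : V} {T : ℕ} {v w : V} :
    (network (withTail σ x T)).Adj (Sum.inl v) (Sum.inl w) ↔ (network σ).Adj v w := by
  simp [network, withTail]

theorem withTail_adj_inl_inr {σ : Profile V} {x : V} {T : ℕ} {v : V} {i : Fin (T + 1)} :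
    (network (withTail σ x T)).Adj (Sum.inl v) (Sum.inr i) ↔ v = x ∧ i.1 = 0 := by
  cases i using Fin.cases <;> simp [network, withTail]

theorem withTail_adj_inr {σ : Profile V} {x : V} {T : ℕ} {i j : Fin (T + 1)} :
    (network (withTail σ x T)).Adj (Sum.inr i) (Sum.inr j) ↔ i.1 = j.1 + 1 ∨ j.1 = i.1 + 1 := by
  cases i using Fin.cases <;> cases j using Fin.cases <;>
    simp [network, withTail, Fin.ext_iff] <;> omega

theorem withTail_deviate (σ : Profile V) (x : V) (T : ℕ) (u : V) (S : {S : Finset V // u ∉ S})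
    (S' : {S : Finset (V ⊕ Fin (T + 1)) // Sum.inl u ∉ S})
    (hS : S'.1 = S.1.map Function.Embedding.inl) :
    deviate (withTail σ x T) (Sum.inl u) S' = withTail (deviate σ u S) x T := by
  funext v
  apply Subtype.ext
  by_cases h : v = Sum.inl u
  · subst h
    rw [deviate_self, hS]
    simp [withTail, deviate_self]
  · rw [deviate_of_ne _ _ _ h]
    rcases v with v | i
    · have hv : v ≠ u := fun h' => h (by rw [h'])
      simp [withTail, deviate_of_ne σ u S hv]
    · rfl

/-- The potential is the distance from `u` truncated at `N`, continued linearly along the tail.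
Truncation gives `x` the value exactly `N` and keeps the potential finite even if a deviation
disconnects the network. -/
theorem withTail_edist_inr_ge (σ : Profile V) (x : V) (T : ℕ) (u : V) (N : ℕ)
    (hN : (N : ℕ∞) ≤ (network σ).edist u x) (i : Fin (T + 1)) :
    ((N + i.1 + 1 : ℕ) : ℕ∞) ≤ (network (withTail σ x T)).edist (Sum.inl u) (Sum.inr i) := by
  let φ : V ⊕ Fin (T + 1) → ℤ := fun
    | Sum.inl v => ((min (N : ℕ∞) ((network σ).edist u v)).toNat : ℤ)
    | Sum.inr i => N + i.1 + 1
  have hx : φ (Sum.inl x) = N := by simp [φ, min_eq_left hN]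
  have hu : φ (Sum.inl u) = 0 := by simp [φ]
  refine le_edist_of_potential _ φ ?_ _ _ _ ?_
  · have hle : ∀ v, φ (Sum.inl v) ≤ N := by
      intro v
      have : (min (N : ℕ∞) ((network σ).edist u v)).toNat ≤ N := by
        have := ENat.toNat_le_toNat (min_le_left (N : ℕ∞) ((network σ).edist u v))
          (ENat.natCast_ne_top N)
        simpa using this
      simpa [φ] using this
    rintro (v | i) (w | j) h
    · rw [withTail_adj_inl] at h
      have h1 : min (N : ℕ∞) ((network σ).edist u w) ≤ min (N : ℕ∞) ((network σ).edist u v) + 1 := by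
        rw [min_add]
        refine min_le_min le_self_add ?_
        have := edist_le_one_of_adj h
        rw [Nat.cast_one] at this
        exact SimpleGraph.edist_triangle.trans (add_le_add le_rfl this)
      have hne : min (N : ℕ∞) ((network σ).edist u v) ≠ ⊤ :=
        ne_top_of_le_ne_top (ENat.natCast_ne_top N) (min_le_left _ _)
      have h2 := ENat.toNat_le_toNat h1 (by simp [hne])
      rw [ENat.toNat_add hne (by simp)] at h2
      simp only [φ]
      simp only [ENat.toNat_one] at h2
      exact_mod_cast h2
    · rw [withTail_adj_inl_inr] at h
      rw [h.1, hx]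
      simp [φ, h.2]
    · have := hle w
      simp only [φ] at this ⊢
      omega
    · rw [withTail_adj_inr] at h
      simp only [φ]
      omega
  · rw [hu]
    simp only [φ]
    push_cast
    omega

theorem withTail_edist_inl_le (σ : Profile V) (x : V) (T : ℕ) (u v : V) :
    (network (withTail σ x T)).edist (Sum.inl u) (Sum.inl v) ≤ (network σ).edist u v := by
  refine le_iInf fun p => ?_
  have := SimpleGraph.edist_le (p.map (⟨Sum.inl, fun h => withTail_adj_inl.2 h⟩ :
    network σ →g network (withTail σ x T)))
  simpa using this

theorem withTail_edist_inr_le (σ : Profile V) (x : V) (T : ℕ) (i : Fin (T + 1)) :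
    (network (withTail σ x T)).edist (Sum.inl x) (Sum.inr i) ≤ ((i.1 + 1 : ℕ) : ℕ∞) := by
  obtain ⟨i, hi⟩ := i
  induction i with
  | zero => exact edist_le_one_of_adj (withTail_adj_inl_inr.2 ⟨rfl, rfl⟩)
  | succ i ih =>
    exact edist_triangle_le (ih (by omega))
      (edist_le_one_of_adj (withTail_adj_inr.2 (Or.inr rfl)))

/-- Folding the tail onto `x` sends every edge to an edge or to a point, so it does not lengthen
walks. -/
theorem withTail_edist_inl_ge (σ : Profile V) (x : V) (T : ℕ) (u v : V) :
    (network σ).edist u v ≤ (network (withTail σ x T)).edist (Sum.inl u) (Sum.inl v) := by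
  have key : ∀ (a b : V ⊕ Fin (T + 1)) (p : (network (withTail σ x T)).Walk a b),
      (network σ).edist (a.elim id fun _ => x) (b.elim id fun _ => x) ≤ p.length := by
    intro a b p
    induction p with
    | nil => simp
    | @cons a c b hadj p ih =>
      have h1 : (network σ).edist (a.elim id fun _ => x) (c.elim id fun _ => x) ≤ (1 : ℕ) := by
        rcases a with v | i <;> rcases c with w | j
        · exact edist_le_one_of_adj (withTail_adj_inl.1 hadj)
        · simp [(withTail_adj_inl_inr.1 hadj).1]
        · simp [(withTail_adj_inl_inr.1 hadj.symm).1]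
        · simp
      have h2 := edist_triangle_le h1 ih
      rwa [add_comm 1] at h2
  exact le_iInf fun p => key _ _ p

theorem withTail_connected {σ : Profile V} (x : V) (T : ℕ) (h : (network σ).Connected) :
    (network (withTail σ x T)).Connected := by
  have hx : ∀ w, (network (withTail σ x T)).Reachable (Sum.inl x) w := by
    rintro (v | i)
    · exact (h x v).map (⟨Sum.inl, fun h => withTail_adj_inl.2 h⟩ :
        network σ →g network (withTail σ x T))
    · exact SimpleGraph.reachable_of_edist_ne_top
        (ne_top_of_le_ne_top (ENat.natCast_ne_top _) (withTail_edist_inr_le σ x T i))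
  have : Nonempty (V ⊕ Fin (T + 1)) := ⟨Sum.inl x⟩
  exact ⟨fun a b => (hx a).symm.trans (hx b)⟩

/-- The situation in which a long path is attached to a node on the boundary of the view. -/
def tailRealization [Finite V] {k : ℕ} (hk : 1 ≤ k) {σ : Profile V} (hσ : (network σ).Connected)
    (u x : V) (hx : (k : ℕ∞) ≤ (network σ).edist u x) (T : ℕ) : Realization k σ u where
  Player := V ⊕ Fin (T + 1)
  finite := inferInstance
  profile := withTail σ x T
  connected := withTail_connected x T hσ
  emb :=
    { toFun := fun v => Sum.inl v.1
      inj' := fun v w h => Subtype.ext (Sum.inl_injective h)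
      map_rel_iff' := withTail_adj_inl }
  range_emb := by
    ext w
    simp only [Set.mem_range, ball, centre, Set.mem_ofPred_eq]
    constructor
    · rintro ⟨v, rfl⟩
      exact (withTail_edist_inl_le σ x T u v.1).trans v.2
    · intro hw
      rcases w with v | i
      · exact ⟨⟨v, (withTail_edist_inl_ge σ x T u v).trans hw⟩, rfl⟩
      · have h1 := (withTail_edist_inr_ge σ x T u k hx i).trans hw
        have : k + i.1 + 1 ≤ k := by exact_mod_cast h1
        omega
  same_strategy := by
    intro y
    simp only [centre]
    change y ∈ (withTail σ x T (Sum.inl u)).1 ↔ ∃ v : ball (network σ) k u, v.1 ∈ (σ u).1 ∧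
      Sum.inl v.1 = y
    constructor
    · intro hy
      obtain ⟨v, hv, rfl⟩ := Finset.mem_map.1 hy
      have hd := edist_le_one_of_adj (G := network σ) (Or.inl hv : (network σ).Adj u v)
      exact ⟨⟨v, hd.trans (by exact_mod_cast hk)⟩, hv, rfl⟩
    · rintro ⟨v, hv, rfl⟩
      exact Finset.mem_map.2 ⟨v.1, hv, rfl⟩

/-- A certificate that no deviation helps: the deviation leaves some node `x` at distance `k` so
far away that a long path attached to `x` makes it unprofitable. -/
def Robust (α : ℝ) (k : ℕ) (σ : Profile V) (u : V) : Prop :=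
  ∀ S : {S : Finset V // u ∉ S}, ∃ (x : V) (N : ℕ), (network σ).edist u x = k ∧
    (N : ℕ∞) ≤ (network (deviate σ u S)).edist u x ∧
    α * (σ u).1.card + k ≤ α * S.1.card + N

/-- A tail at `x` longer than every old distance makes its last node decisive: the eccentricity of
`u` is at most `k + T + 1` before the deviation and at least `N + T + 1` after it. As `x` has
distance `k`, the tail itself lies outside the view. -/
theorem isLKE_of_robust [Finite V] {α : ℝ} (hα : 0 ≤ α) {k : ℕ} (hk : 1 ≤ k) {σ : Profile V}
    (hσ : (network σ).Connected) (h : ∀ u, Robust α k σ u) : IsLKE α k σ := by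
  intro u S
  let S' : {S : Finset V // u ∉ S} := ⟨S.1.map (Function.Embedding.subtype _), by
    intro hu
    obtain ⟨v, hv, hvu⟩ := Finset.mem_map.1 hu
    refine S.2 ?_
    have : v = centre (network σ) k u := Subtype.ext hvu
    exact this ▸ hv⟩
  obtain ⟨x, N, hx, hN, hc⟩ := h u S'
  have hbdd : ∃ T : ℕ, ∀ v, (network σ).edist u v ≤ T := by
    cases nonempty_fintype V
    refine ⟨Finset.univ.sup fun v => (network σ).dist u v, fun v => ?_⟩
    rw [← (hσ u v).coe_dist_eq_edist]
    exact_mod_cast Finset.le_sup (f := fun v => (network σ).dist u v) (Finset.mem_univ v)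
  obtain ⟨T, hT⟩ := hbdd
  refine le_trans ?_ (le_iSup _ (tailRealization hk hσ u x hx.ge T))
  have hold : (network (withTail σ x T)).eccent (Sum.inl u) ≤ ((k + T + 1 : ℕ) : ℕ∞) := by
    rw [SimpleGraph.eccent_le_iff]
    rintro (v | i)
    · refine (withTail_edist_inl_le σ x T u v).trans ((hT v).trans ?_)
      exact_mod_cast (by omega : T ≤ k + T + 1)
    · refine (edist_triangle_le ((withTail_edist_inl_le σ x T u x).trans hx.le)
        (withTail_edist_inr_le σ x T i)).trans ?_
      exact_mod_cast (by omega : k + (i.1 + 1) ≤ k + T + 1)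
  have hnew : ((N + T + 1 : ℕ) : ℕ∞) ≤ (network (withTail (deviate σ u S') x T)).eccent
      (Sum.inl u) :=
    (withTail_edist_inr_ge (deviate σ u S') x T u N hN (Fin.last T)).trans
      SimpleGraph.edist_le_eccent
  have hcost : cost α (withTail σ x T) (Sum.inl u)
      ≤ cost α (withTail (deviate σ u S') x T) (Sum.inl u) := by
    have h1 : cost α (withTail σ x T) (Sum.inl u)
        ≤ ENNReal.ofReal (α * (σ u).1.card + (k + T + 1)) := by
      rw [ENNReal.ofReal_add (by positivity) (by positivity), ENNReal.ofReal_mul hα,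
        ENNReal.ofReal_natCast]
      refine add_le_add (by simp [withTail]) ?_
      have : (((network (withTail σ x T)).eccent (Sum.inl u) : ℕ∞) : ℝ≥0∞)
          ≤ (((k + T + 1 : ℕ) : ℕ∞) : ℝ≥0∞) := by exact_mod_cast hold
      refine this.trans ?_
      rw [ENat.toENNReal_coe, ← ENNReal.ofReal_natCast]
      push_cast
      rfl
    have h2 : ENNReal.ofReal (α * S'.1.card + (N + T + 1))
        ≤ cost α (withTail (deviate σ u S') x T) (Sum.inl u) := by
      rw [ENNReal.ofReal_add (by positivity) (by positivity), ENNReal.ofReal_mul hα,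
        ENNReal.ofReal_natCast]
      refine add_le_add (by simp [withTail, deviate_self]) ?_
      have : (((N + T + 1 : ℕ) : ℕ∞) : ℝ≥0∞)
          ≤ (((network (withTail (deviate σ u S') x T)).eccent (Sum.inl u) : ℕ∞) : ℝ≥0∞) := by
        exact_mod_cast hnew
      refine le_trans ?_ this
      rw [ENat.toENNReal_coe, ← ENNReal.ofReal_natCast]
      push_cast
      rfl
    refine h1.trans (le_trans (ENNReal.ofReal_le_ofReal ?_) h2)
    linarith
  -- In `EReal`, nonnegativity of a difference follows from the inequality only when `⊤ - ⊤` is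
  -- ruled out.
  have hfin : cost α (withTail σ x T) (Sum.inl u) ≠ ⊤ := by
    have h1 : (((network (withTail σ x T)).eccent (Sum.inl u) : ℕ∞) : ℝ≥0∞) ≠ ⊤ := by
      rw [Ne, ENat.toENNReal_eq_top]
      exact ne_top_of_le_ne_top (ENat.natCast_ne_top _) hold
    exact ENNReal.add_ne_top.2 ⟨ENNReal.mul_ne_top ENNReal.ofReal_ne_top
      (ENNReal.natCast_ne_top _), h1⟩
  have hdev : deviate (tailRealization hk hσ u x hx.ge T).profile
      (tailRealization hk hσ u x hx.ge T).self
      ((tailRealization hk hσ u x hx.ge T).transport S)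
      = withTail (deviate σ u S') x T := by
    refine withTail_deviate σ x T u S' _ ?_
    ext w
    refine Finset.mem_map.trans (Iff.trans ?_ Finset.mem_map.symm)
    simp only [S', Finset.mem_map]
    constructor
    · rintro ⟨v, hv, rfl⟩
      exact ⟨v.1, ⟨v, hv, rfl⟩, rfl⟩
    · rintro ⟨_, ⟨v, hv, rfl⟩, rfl⟩
      exact ⟨v, hv, rfl⟩
  rw [hdev]
  change (0 : EReal) ≤ ((cost α (withTail (deviate σ u S') x T) (Sum.inl u) : ℝ≥0∞) : EReal)
    - ((cost α (withTail σ x T) (Sum.inl u) : ℝ≥0∞) : EReal)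
  rw [EReal.sub_nonneg]
  · exact_mod_cast hcost
  · right
    rwa [Ne, EReal.coe_ennreal_eq_top_iff]
  · right
    exact EReal.coe_ennreal_ne_bot _

end Generic

/-! ### Unprofitable deviations -/

section Certificates

variable {V : Type}

/-- The old edges bought by `u` have disappeared unless `S` keeps them, so they impose no condition
on `φ`; the potential may jump across them. -/
theorem le_edist_deviate {σ : Profile V} {u : V} {S : {S : Finset V // u ∉ S}} (φ : V → ℤ)
    (h1 : ∀ v w, v ≠ u → w ≠ u → (network σ).Adj v w → φ w ≤ φ v + 1)
    (h2 : ∀ w, w ∈ S.1 ∨ u ∈ (σ w).1 → φ w ≤ φ u + 1 ∧ φ u ≤ φ w + 1) (x : V) (N : ℕ)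
    (hN : (N : ℤ) ≤ φ x - φ u) : (N : ℕ∞) ≤ (network (deviate σ u S)).edist u x := by
  refine le_edist_of_potential _ φ (fun v w h => ?_) u x N hN
  by_cases hv : v = u
  · subst hv
    exact (h2 w (adj_deviate_self h)).1
  · by_cases hw : w = u
    · subst hw
      exact (h2 v (adj_deviate_self h.symm)).2
    · exact h1 v w hv hw (adj_of_adj_deviate h hv hw)

/-- The condition that `Robust` imposes on a single deviation. -/
def Unprofitable (α : ℝ) (k : ℕ) (σ : Profile V) (u : V) (S : {S : Finset V // u ∉ S}) : Prop :=
  ∃ (x : V) (N : ℕ), (network σ).edist u x = k ∧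
    (N : ℕ∞) ≤ (network (deviate σ u S)).edist u x ∧
    α * (σ u).1.card + k ≤ α * S.1.card + N

/-- If some `x c` stays farther than `k - l`, the gain is at most `l - 1 ≤ α`, the price of one
additional edge. Otherwise no two of the `x c` share a bought edge, and `hcard` says that this many
edges cost more than the largest possible gain `k - 1`. -/
theorem unprofitable_of_card_lt {α : ℝ} {k l : ℕ} {σ : Profile V} {u : V}
    {S : {S : Finset V // u ∉ S}} (hα : 0 < α) (hl : 1 ≤ l) (hlk : l ≤ k) (hlα : (l : ℝ) ≤ α + 1)
    {ι : Type} [Fintype ι] [Nonempty ι] (x : ι → V) (hx : ∀ c, (network σ).edist u (x c) = k)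
    (hsep : ∀ c c', c ≠ c' → ((2 * (k - l) : ℕ) : ℕ∞) ≤ (network σ).edist (x c) (x c'))
    (hcard : (k : ℝ) ≤ α * (Fintype.card ι - (σ u).1.card) + 1)
    (hS : (σ u).1.card < S.1.card) : Unprofitable α k σ u S := by
  have hS' : ((σ u).1.card : ℝ) + 1 ≤ S.1.card := by exact_mod_cast hS
  by_cases h : ∀ c, (network (deviate σ u S)).edist u (x c) ≤ ((k - l : ℕ) : ℕ∞)
  · have hle := card_le_of_edist_deviate_le (T := k - l) Finset.univ x (fun c _ => h c)
      (fun c _ => by rw [hx c]; exact_mod_cast (by omega : k - l < k))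
      (fun c _ c' _ => hsep c c')
    rw [Finset.card_univ] at hle
    have hle' : (Fintype.card ι : ℝ) ≤ S.1.card := by exact_mod_cast hle
    obtain ⟨c⟩ := (inferInstance : Nonempty ι)
    -- Here the trivial bound suffices: `x c` is not `u`, hence at distance at least one.
    refine ⟨x c, 1, hx c, ?_, ?_⟩
    · rw [Nat.cast_one, Order.one_le_iff_pos]
      refine SimpleGraph.edist_pos_of_ne ?_
      intro hu
      have := hx c
      rw [← hu, SimpleGraph.edist_self] at this
      have : 0 = k := by exact_mod_cast this
      omega
    · push_cast
      nlinarith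
  · push Not at h
    obtain ⟨c, hc⟩ := h
    refine ⟨x c, k - l + 1, hx c, ?_, ?_⟩
    · rw [Nat.cast_add, Nat.cast_one]
      exact Order.add_one_le_of_lt hc
    · push_cast [Nat.cast_sub hlk]
      nlinarith

/-- By pigeonhole: a bought edge brings at most one of these nodes to distance `k - 1`, and there
are more nodes than edges. -/
theorem unprofitable_of_card_eq {α : ℝ} {k : ℕ} {σ : Profile V} {u : V}
    {S : {S : Finset V // u ∉ S}} (hk : 1 ≤ k)
    {ι : Type} (C : Finset ι) (x : ι → V) (hx : ∀ c ∈ C, (network σ).edist u (x c) = k)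
    (hsep : ∀ c ∈ C, ∀ c' ∈ C, c ≠ c' →
      ((2 * (k - 1) : ℕ) : ℕ∞) ≤ (network σ).edist (x c) (x c'))
    (hcard : S.1.card < C.card)
    (hS : (σ u).1.card = S.1.card) : Unprofitable α k σ u S := by
  by_cases h : ∀ c ∈ C, (network (deviate σ u S)).edist u (x c) ≤ ((k - 1 : ℕ) : ℕ∞)
  · have hle := card_le_of_edist_deviate_le (T := k - 1) C x h
      (fun c hc => by rw [hx c hc]; exact_mod_cast (by omega : k - 1 < k))
      hsep
    omega
  · push Not at h
    obtain ⟨c, hc, hd⟩ := h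
    refine ⟨x c, k, hx c hc, ?_, by rw [hS]⟩
    have := Order.add_one_le_of_lt hd
    have h2 : ((k : ℕ) : ℕ∞) = ((k - 1 : ℕ) : ℕ∞) + 1 := by
      exact_mod_cast (by omega : k = k - 1 + 1)
    rwa [h2]

/-- Dropping all edges is bad for a player to whom nobody else buys an edge. -/
theorem unprofitable_of_isolated {α : ℝ} {k : ℕ} {σ : Profile V} {u : V}
    {S : {S : Finset V // u ∉ S}} (hk : 1 ≤ k) (hu : ∀ w, u ∉ (σ w).1) (hS : S.1 = ∅)
    {x : V} (hx : (network σ).edist u x = k) : Unprofitable α k σ u S := by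
  classical
  obtain ⟨N, hN⟩ := exists_nat_ge (α * (σ u).1.card + k)
  refine ⟨x, N, hx, ?_, by simpa [hS] using hN⟩
  have hxu : x ≠ u := by
    rintro rfl
    rw [SimpleGraph.edist_self] at hx
    have : 0 = k := by exact_mod_cast hx
    omega
  refine le_edist_deviate (fun v => if v = u then 0 else N) ?_ ?_ x N (by simp [hxu])
  · intro v w hv hw _
    simp [hv, hw]
  · intro w hw
    simp [hS, hu w] at hw

end Certificates

/-! ### The norm on `ℤ/P` -/

section CyclicNorm

/-- The distance of an element of `ℤ/P` to zero. -/
def cyclicNorm {P : ℕ} (z : ZMod P) : ℕ := z.valMinAbs.natAbs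

theorem cyclicNorm_add_le {P : ℕ} (a b : ZMod P) :
    cyclicNorm (a + b) ≤ cyclicNorm a + cyclicNorm b :=
  (ZMod.natAbs_valMinAbs_add_le a b).trans (Int.natAbs_add_le _ _)

theorem cyclicNorm_neg {P : ℕ} (a : ZMod P) : cyclicNorm (-a) = cyclicNorm a :=
  ZMod.natAbs_valMinAbs_neg a

theorem cyclicNorm_sub_comm {P : ℕ} (a b : ZMod P) : cyclicNorm (a - b) = cyclicNorm (b - a) := by
  rw [← cyclicNorm_neg, neg_sub]

theorem cyclicNorm_zero {P : ℕ} : cyclicNorm (0 : ZMod P) = 0 := by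
  simp [cyclicNorm]

/-- A representative of absolute value below `B` would differ from `y` by a multiple of `P` strictly
between `0` and `P` in absolute value. -/
theorem cyclicNorm_intCast_ge {P : ℕ} (y : ℤ) (B : ℕ) (h1 : (B : ℤ) ≤ |y|)
    (h2 : |y| + B ≤ P) : B ≤ cyclicNorm (y : ZMod P) := by
  unfold cyclicNorm
  have hcast : (((y : ZMod P).valMinAbs : ℤ) : ZMod P) = (y : ZMod P) := ZMod.coe_valMinAbs _
  generalize (y : ZMod P).valMinAbs = v at hcast
  rw [ZMod.intCast_eq_intCast_iff_dvd_sub] at hcast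
  obtain ⟨m, hm⟩ := hcast
  by_contra hlt
  have hv : |v| < B := by
    rw [Int.abs_eq_natAbs]
    exact_mod_cast not_le.1 hlt
  rw [abs_lt] at hv
  rcases abs_cases y with ⟨hy, _⟩ | ⟨hy, _⟩ <;> rw [hy] at h1 h2
  · have h3 : 0 < (P : ℤ) * m := by linarith
    have h4 : (P : ℤ) * m < P * 1 := by linarith
    have hP : (0 : ℤ) < P := by linarith
    have := pos_of_mul_pos_right h3 hP.le
    have := lt_of_mul_lt_mul_left h4 hP.le
    omega
  · have h3 : 0 < (P : ℤ) * (-m) := by linarith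
    have h4 : (P : ℤ) * (-m) < P * 1 := by linarith
    have hP : (0 : ℤ) < P := by linarith
    have := pos_of_mul_pos_right h3 hP.le
    have := lt_of_mul_lt_mul_left h4 hP.le
    omega

theorem cyclicNorm_intCast_le {P : ℕ} [NeZero P] (y : ℤ) :
    cyclicNorm (y : ZMod P) ≤ y.natAbs := by
  have h1 : ∀ s : ℤ, s.natAbs = 1 → cyclicNorm (s : ZMod P) ≤ 1 := by
    have hone : cyclicNorm (1 : ZMod P) ≤ 1 := by
      unfold cyclicNorm
      rw [ZMod.valMinAbs_natAbs_eq_min]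
      refine (min_le_left _ _).trans ?_
      rw [ZMod.val_one_eq_one_mod]
      exact Nat.mod_le _ _
    intro s hs
    rcases Int.natAbs_eq s with h | h <;> rw [h, hs]
    · simpa using hone
    · push_cast
      rwa [cyclicNorm_neg]
  induction y using Int.induction_on with
  | zero => simp [cyclicNorm_zero]
  | succ i ih =>
    push_cast at ih ⊢
    refine (cyclicNorm_add_le _ _).trans ?_
    have := h1 1 rfl
    push_cast at this
    omega
  | pred i ih =>
    push_cast at ih ⊢
    rw [sub_eq_add_neg]
    refine (cyclicNorm_add_le _ _).trans ?_
    have := h1 (-1) rfl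
    push_cast at this
    omega

theorem two_mul_abs_valMinAbs_le {P : ℕ} [NeZero P] (z : ZMod P) : 2 * |z.valMinAbs| ≤ P := by
  have := ZMod.natAbs_valMinAbs_le z
  rw [Int.abs_eq_natAbs]
  omega

end CyclicNorm

/-! ### The stretched torus and its strategies -/

/-- The nodes of the stretched torus: two classes of intersections, the inner nodes of the paths
of length `l` that join them, and `r` leaves. The path `inner a f` starts in `even a` and leads
in the diagonal direction with signs `f`. -/
inductive Node {d : ℕ} (δ : Fin d → ℕ) (l r : ℕ) : Type
  | even (a : ∀ i, ZMod (δ i))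
  | odd (b : ∀ i, ZMod (δ i))
  | inner (a : ∀ i, ZMod (δ i)) (f : Fin d → Bool) (t : Fin (l - 1))
  | leaf (i : Fin r)

namespace Node

variable {d : ℕ} {δ : Fin d → ℕ} {l r : ℕ}

/-- The label of the odd intersection next to `even a` in direction `f`. -/
def shift (a : ∀ i, ZMod (δ i)) (f : Fin d → Bool) : ∀ i, ZMod (δ i) :=
  fun i => if f i then a i else a i - 1

/-- The node at position `s` of the path that starts in `even a` in direction `f`. -/
def along (a : ∀ i, ZMod (δ i)) (f : Fin d → Bool) (s : ℕ) : Node δ l r :=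
  if s = 0 then even a else if h : s - 1 < l - 1 then inner a f ⟨s - 1, h⟩ else odd (shift a f)

theorem along_zero (a : ∀ i, ZMod (δ i)) (f : Fin d → Bool) :
    (along a f 0 : Node δ l r) = even a := rfl

theorem along_inner (a : ∀ i, ZMod (δ i)) (f : Fin d → Bool) (t : Fin (l - 1)) :
    (along a f (t.1 + 1) : Node δ l r) = inner a f t := by
  simp [along]

theorem along_last (hl : 2 ≤ l) (a : ∀ i, ZMod (δ i)) (f : Fin d → Bool) :
    (along a f l : Node δ l r) = odd (shift a f) := by
  have h : l ≠ 0 := by omega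
  simp [along, h]

theorem along_of_lt (a : ∀ i, ZMod (δ i)) (f : Fin d → Bool) {s : ℕ} (h0 : s ≠ 0)
    (h : s - 1 < l - 1) : (along a f s : Node δ l r) = inner a f ⟨s - 1, h⟩ := by
  simp [along, h0, h]

theorem along_eq_inner {a b : ∀ i, ZMod (δ i)} {f g : Fin d → Bool} {s : ℕ} {t : Fin (l - 1)} :
    (along a f s : Node δ l r) = inner b g t ↔ a = b ∧ f = g ∧ s = t.1 + 1 := by
  unfold along
  split_ifs with h1 h2
  · simp [h1]
  · simp only [inner.injEq, Fin.ext_iff]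
    have : s - 1 = t.1 ↔ s = t.1 + 1 := by omega
    rw [this]
  · have := t.2
    simp only [false_iff, not_and]
    omega

/-- The strategies on the stretched torus: every inner node buys the next edge of its path, the
first one also buys the edge to the start of the path, and leaves buy their only edge. -/
def bought (x : Node δ l r) : Set (Node δ l r) := fun y =>
  match x with
  | even _ => False
  | odd _ => False
  | inner a f t => y = along a f (t.1 + 2) ∨ (t.1 = 0 ∧ y = even a)
  | leaf _ => y = odd 0

theorem bought_finite (x : Node δ l r) : (bought x).Finite := by
  rcases x with a | b | ⟨a, f, t⟩ | i
  · exact Set.finite_empty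
  · exact Set.finite_empty
  · refine Set.Finite.subset (s := {along a f (t.1 + 2), even a}) (by simp) ?_
    rintro y (h | h)
    · exact Or.inl h
    · exact Or.inr h.2
  · exact Set.finite_singleton (odd 0)

theorem self_notMem_bought (x : Node δ l r) : x ∉ bought x := by
  rcases x with a | b | ⟨a, f, t⟩ | i
  · exact id
  · exact id
  · rintro (h | ⟨_, h⟩)
    · have := (along_eq_inner.1 h.symm).2.2
      omega
    · cases h
  · intro h
    change leaf i = odd 0 at h
    cases h

/-- The profile whose network is the stretched torus. -/
def profile (δ : Fin d → ℕ) (l r : ℕ) : Profile (Node δ l r) :=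
  fun x => ⟨(bought_finite x).toFinset, by simpa using self_notMem_bought x⟩

theorem mem_profile {x y : Node δ l r} : y ∈ (profile δ l r x).1 ↔ y ∈ bought x := by
  simp [profile]

theorem adj_cases (hl : 2 ≤ l) {v w : Node δ l r} (h : (network (profile δ l r)).Adj v w) :
    (∃ a f s, s < l ∧ ((v = along a f s ∧ w = along a f (s + 1)) ∨
      (w = along a f s ∧ v = along a f (s + 1)))) ∨
    (∃ i, (v = leaf i ∧ w = odd 0) ∨ (w = leaf i ∧ v = odd 0)) := by
  have key : ∀ v w : Node δ l r, w ∈ bought v →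
      (∃ a f s, s < l ∧ ((v = along a f s ∧ w = along a f (s + 1)) ∨
        (w = along a f s ∧ v = along a f (s + 1)))) ∨ (∃ i, v = leaf i ∧ w = odd 0) := by
    intro v w h
    rcases v with a | b | ⟨a, f, t⟩ | i
    · exact h.elim
    · exact h.elim
    · left
      rcases h with h | ⟨ht, h⟩
      · refine ⟨a, f, t.1 + 1, by omega, Or.inl ⟨(along_inner a f t).symm, h⟩⟩
      · refine ⟨a, f, 0, by omega, Or.inr ⟨h, ?_⟩⟩
        rw [← along_inner a f t, ht]
    · exact Or.inr ⟨i, rfl, h⟩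
  rcases h with h | h <;> rw [mem_profile] at h
  · rcases key _ _ h with h | ⟨i, h⟩
    · exact Or.inl h
    · exact Or.inr ⟨i, Or.inl h⟩
  · rcases key _ _ h with ⟨a, f, s, hs, h⟩ | ⟨i, h⟩
    · exact Or.inl ⟨a, f, s, hs, h.symm⟩
    · exact Or.inr ⟨i, Or.inr h⟩

theorem adj_along (hl : 2 ≤ l) (a : ∀ i, ZMod (δ i)) (f : Fin d → Bool) {s : ℕ} (hs : s < l) :
    (network (profile δ l r)).Adj (along a f s) (along a f (s + 1)) := by
  by_cases h0 : s = 0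
  · subst h0
    right
    have h1 : (along a f (0 + 1) : Node δ l r) = inner a f ⟨0, by omega⟩ :=
      along_inner a f ⟨0, by omega⟩
    rw [mem_profile, h1]
    exact Or.inr ⟨rfl, rfl⟩
  · left
    rw [mem_profile, along_of_lt a f h0 (by omega)]
    left
    congr 1
    change s + 1 = s - 1 + 2
    omega

theorem adj_leaf (i : Fin r) : (network (profile δ l r)).Adj (leaf i) (odd 0) :=
  Or.inl (mem_profile.2 rfl)

theorem edist_along_le (hl : 2 ≤ l) (a : ∀ i, ZMod (δ i)) (f : Fin d → Bool) (s m : ℕ)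
    (h : s + m ≤ l) :
    (network (profile δ l r)).edist (along a f s) (along a f (s + m)) ≤ m := by
  induction m with
  | zero => simp
  | succ m ih =>
    exact edist_triangle_le (ih (by omega)) (edist_le_one_of_adj (adj_along hl a f (by omega)))

/-! ### Coordinates: straight lines and lower bounds on distances -/

section Coordinates

/-- The embedding of the labels `ℤ/δ` into the coordinates `ℤ/2lδ`. -/
def stretch (l δ : ℕ) : ZMod δ →+ ZMod (2 * l * δ) :=
  ZMod.lift δ ⟨(AddMonoidHom.mulLeft (2 * l : ZMod (2 * l * δ))).comp
    (Int.castAddHom (ZMod (2 * l * δ))), by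
      have := ZMod.natCast_self (2 * l * δ)
      push_cast at this
      simpa using this⟩

theorem stretch_intCast (l δ : ℕ) (m : ℤ) :
    stretch l δ (m : ZMod δ) = ((2 * l * m : ℤ) : ZMod (2 * l * δ)) := by
  simp [stretch]

theorem stretch_one (l δ : ℕ) : stretch l δ 1 = ((2 * l : ℤ) : ZMod (2 * l * δ)) := by
  have := stretch_intCast l δ 1
  simpa using this

/-- The sign of a direction. -/
def sign (b : Bool) : ℤ := if b then 1 else -1

theorem sign_not (b : Bool) : sign (!b) = -sign b := by cases b <;> rfl

theorem sign_eq_neg {b c : Bool} (h : b ≠ c) : sign b = -sign c := by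
  revert h; cases b <;> cases c <;> simp [sign]

theorem sign_cases (b : Bool) : sign b = 1 ∨ sign b = -1 := by cases b <;> simp [sign]

theorem abs_mul_sign (m : ℤ) (b : Bool) : |m * sign b| = |m| := by
  cases b <;> simp [sign]

/-- The coordinates of the nodes. -/
def coord (x : Node δ l r) (i : Fin d) : ZMod (2 * l * δ i) :=
  match x with
  | even a => stretch l (δ i) (a i)
  | odd b => stretch l (δ i) (b i) + ((l : ℤ) : ZMod (2 * l * δ i))
  | inner a f t => stretch l (δ i) (a i) + (((t.1 + 1 : ℕ) * sign (f i) : ℤ) : ZMod (2 * l * δ i))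
  | leaf _ => stretch l (δ i) 0 + ((l : ℤ) : ZMod (2 * l * δ i))

/-- The far end fits the formula because an odd intersection sits `l` above its label, while a
negative sign lowers the label by one, that is, the coordinate by `2l`. -/
theorem coord_along (hl : 2 ≤ l) (a : ∀ i, ZMod (δ i)) (f : Fin d → Bool) {s : ℕ} (hs : s ≤ l)
    (i : Fin d) : coord (along a f s : Node δ l r) i =
      stretch l (δ i) (a i) + ((s * sign (f i) : ℤ) : ZMod (2 * l * δ i)) := by
  by_cases h0 : s = 0
  · subst h0
    simp [along_zero, coord]
  · by_cases h1 : s - 1 < l - 1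
    · rw [along_of_lt a f h0 h1]
      simp only [coord]
      rw [show s - 1 + 1 = s by omega]
    · obtain rfl : s = l := by omega
      rw [along_last hl]
      simp only [coord, shift]
      cases f i
      · simp [map_sub, stretch_one, sign]
        ring
      · simp [sign]

/-- Straight lines are paths. -/
theorem exists_ray (hl : 2 ≤ l) (f : Fin d → Bool) (s : ℕ) :
    (∀ a : ∀ i, ZMod (δ i), ∃ x : Node δ l r,
      (∀ i, coord x i = stretch l (δ i) (a i) + ((s * sign (f i) : ℤ) : ZMod (2 * l * δ i))) ∧
      (network (profile δ l r)).edist (even a) x ≤ s) ∧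
    (∀ b : ∀ i, ZMod (δ i), ∃ x : Node δ l r,
      (∀ i, coord x i = stretch l (δ i) (b i) +
        ((l + s * sign (f i) : ℤ) : ZMod (2 * l * δ i))) ∧
      (network (profile δ l r)).edist (odd b) x ≤ s) := by
  induction s using Nat.strong_induction_on with
  | _ s ih =>
    constructor
    · intro a
      by_cases hs : s ≤ l
      · refine ⟨along a f s, fun i => coord_along hl a f hs i, ?_⟩
        have := edist_along_le (r := r) hl a f 0 s (by omega)
        rwa [zero_add, along_zero] at this
      · obtain ⟨x, hx, hd⟩ := (ih (s - l) (by omega)).2 (shift a f)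
        refine ⟨x, fun i => ?_, ?_⟩
        · rw [hx]
          push_cast [Nat.cast_sub (not_le.1 hs).le]
          simp only [shift]
          cases f i
          · simp [map_sub, stretch_one, sign]
            ring
          · simp [sign]
        · have h1 := edist_along_le (r := r) hl a f 0 l (by omega)
          rw [zero_add, along_zero, along_last hl] at h1
          have h2 := edist_triangle_le h1 hd
          rwa [show l + (s - l) = s by omega] at h2
    · intro b
      -- From an odd intersection the line runs backwards along the path that starts in this `a` in
      -- the opposite direction.
      let a : ∀ i, ZMod (δ i) := fun i => if f i then b i + 1 else b i
      have hab : shift a (fun i => !f i) = b := by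
        funext i
        simp only [shift, a]
        cases f i <;> simp
      by_cases hs : s ≤ l
      · refine ⟨along a (fun i => !f i) (l - s), fun i => ?_, ?_⟩
        · rw [coord_along hl _ _ (by omega), sign_not]
          push_cast [Nat.cast_sub hs]
          simp only [a]
          cases f i
          · simp [sign]
            ring
          · simp [stretch_one, sign]
            ring
        · have h1 := edist_along_le (r := r) hl a (fun i => !f i) (l - s) s (by omega)
          rwa [show l - s + s = l by omega, along_last hl, hab, SimpleGraph.edist_comm] at h1
      · obtain ⟨x, hx, hd⟩ := (ih (s - l) (by omega)).1 a
        refine ⟨x, fun i => ?_, ?_⟩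
        · rw [hx]
          push_cast [Nat.cast_sub (not_le.1 hs).le]
          simp only [a]
          cases f i
          · simp [sign]
            ring
          · simp [stretch_one, sign]
            ring
        · have h1 := edist_along_le (r := r) hl a (fun i => !f i) 0 l (by omega)
          rw [zero_add, along_zero, along_last hl, hab, SimpleGraph.edist_comm] at h1
          have h2 := edist_triangle_le h1 hd
          rwa [show l + (s - l) = s by omega] at h2

variable [∀ i, NeZero (δ i)]

theorem coord_lipschitz (hl : 2 ≤ l) {v w : Node δ l r} (h : (network (profile δ l r)).Adj v w)
    (i : Fin d) : cyclicNorm (coord w i - coord v i) ≤ 1 := by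
  have : NeZero (2 * l * δ i) := ⟨by have := NeZero.ne (δ i); positivity⟩
  have key : ∀ a f s, s < l → cyclicNorm (coord (along a f (s + 1) : Node δ l r) i
      - coord (along a f s : Node δ l r) i) ≤ 1 := by
    intro a f s hs
    rw [coord_along hl a f hs, coord_along hl a f hs.le, add_sub_add_left_eq_sub, ← Int.cast_sub]
    refine (cyclicNorm_intCast_le _).trans ?_
    push_cast
    rcases sign_cases (f i) with h | h <;> rw [h] <;> omega
  rcases adj_cases hl h with ⟨a, f, s, hs, ⟨rfl, rfl⟩ | ⟨rfl, rfl⟩⟩ | ⟨j, ⟨rfl, rfl⟩ | ⟨rfl, rfl⟩⟩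
  · exact key a f s hs
  · rw [cyclicNorm_sub_comm]
    exact key a f s hs
  · simp [coord, cyclicNorm_zero]
  · simp [coord, cyclicNorm_zero]

theorem cyclicNorm_coord_le (hl : 2 ≤ l) {v w : Node δ l r}
    (h : (network (profile δ l r)).Adj v w) (i : Fin d) (c : ZMod (2 * l * δ i)) :
    cyclicNorm (coord w i - c) ≤ cyclicNorm (coord v i - c) + 1 := by
  have h1 := cyclicNorm_add_le (coord v i - c) (coord w i - coord v i)
  have h2 := coord_lipschitz hl h i
  rw [sub_add_sub_cancel'] at h1
  omega

theorem le_edist_of_coord (hl : 2 ≤ l) (x y : Node δ l r) (i : Fin d) (N : ℕ)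
    (h : N ≤ cyclicNorm (coord x i - coord y i)) :
    (N : ℕ∞) ≤ (network (profile δ l r)).edist x y := by
  rw [SimpleGraph.edist_comm]
  refine le_edist_of_potential _ (fun v => (cyclicNorm (coord v i - coord y i) : ℤ)) ?_ y x N ?_
  · intro v w hvw
    exact_mod_cast cyclicNorm_coord_le hl hvw i _
  · simp only [sub_self, cyclicNorm_zero]
    simpa using h

/-- If the coordinates differ by an integer with suitable bounds, the nodes are far apart. -/
theorem le_edist_of_coord_intCast (hl : 2 ≤ l) (x y : Node δ l r) (i : Fin d) (N : ℕ) (m : ℤ)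
    (h : coord x i - coord y i = (m : ZMod (2 * l * δ i))) (h1 : (N : ℤ) ≤ |m|)
    (h2 : |m| + N ≤ 2 * l * δ i) : (N : ℕ∞) ≤ (network (profile δ l r)).edist x y := by
  refine le_edist_of_coord hl x y i N ?_
  rw [h]
  exact cyclicNorm_intCast_ge m N h1 (by push_cast; exact h2)

end Coordinates

end Node

/-! ### Intersections and leaves cannot improve -/

namespace Node

variable {d : ℕ} {δ : Fin d → ℕ} {l r : ℕ}

theorem stretch_shift (l : ℕ) (a : ∀ i, ZMod (δ i)) (f : Fin d → Bool) (i : Fin d) :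
    stretch l (δ i) (shift a f i) =
      stretch l (δ i) (a i) + ((l * sign (f i) - l : ℤ) : ZMod (2 * l * δ i)) := by
  simp only [shift]
  cases f i
  · simp [map_sub, stretch_one, sign]
    ring
  · simp [sign]

/-- All `2 ^ d` corners serve for both counts; separation `2 * (k - 1)` is what an unchanged number
of edges requires and is more than extra edges require. -/
theorem unprofitable_of_card_le {α : ℝ} {k : ℕ} (hl : 2 ≤ l) (hlk : l ≤ k) (hα : 1 < α)
    (hlα : (l : ℝ) ≤ α + 1) (hcard : (k : ℝ) ≤ α * (2 ^ d - 2) + 1) {u : Node δ l r}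
    {S : {S : Finset (Node δ l r) // u ∉ S}} (x : (Fin d → Bool) → Node δ l r)
    (hx : ∀ f, (network (profile δ l r)).edist u (x f) = k)
    (hsep : ∀ f g, f ≠ g →
      ((2 * (k - 1) : ℕ) : ℕ∞) ≤ (network (profile δ l r)).edist (x f) (x g))
    (hu : ((profile δ l r u).1.card) ≤ 1) (hd : 1 ≤ d)
    (hS : (profile δ l r u).1.card ≤ S.1.card) : Unprofitable α k (profile δ l r) u S := by
  rcases hS.eq_or_lt with h | h
  · refine unprofitable_of_card_eq (by omega) Finset.univ x (fun f _ => hx f)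
      (fun f _ g _ => hsep f g) ?_ h
    rw [Finset.card_univ, Fintype.card_fun, Fintype.card_bool, Fintype.card_fin]
    have : 2 ^ 1 ≤ 2 ^ d := Nat.pow_le_pow_right (by norm_num) hd
    omega
  · refine unprofitable_of_card_lt (by linarith) (by omega) hlk hlα x hx (fun f g hfg => ?_) ?_ h
    · refine le_trans ?_ (hsep f g hfg)
      exact_mod_cast (by omega : 2 * (k - l) ≤ 2 * (k - 1))
    · rw [Fintype.card_fun, Fintype.card_bool, Fintype.card_fin]
      have hu' : ((profile δ l r u).1.card : ℝ) ≤ 1 := by exact_mod_cast hu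
      push_cast
      nlinarith

theorem profile_leaf (y : Fin r) : (profile δ l r (leaf y)).1 = {odd 0} := by
  ext v
  rw [mem_profile, Finset.mem_singleton]
  rfl

theorem leaf_notMem_profile (y : Fin r) (w : Node δ l r) : leaf y ∉ (profile δ l r w).1 := by
  rw [mem_profile]
  rcases w with a | b | ⟨a, f, t⟩ | i
  · exact id
  · exact id
  · rintro (h | ⟨_, h⟩)
    · unfold along at h
      split_ifs at h
    · cases h
  · intro h
    change leaf y = odd 0 at h
    cases h

variable [∀ i, NeZero (δ i)]

/-- Opposite signs put the nodes `2m` apart in coordinate `i`, and a period of at least `4m` leaves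
no shorter way round. -/
theorem le_edist_corners (hl : 2 ≤ l) {m : ℕ} (hP : ∀ i, 4 * m ≤ 2 * l * δ i)
    {x y : Node δ l r} (f g : Fin d → Bool) (c : ∀ i, ZMod (2 * l * δ i)) {i : Fin d}
    (hx : coord x i = c i + ((m * sign (f i) : ℤ) : ZMod (2 * l * δ i)))
    (hy : coord y i = c i + ((m * sign (g i) : ℤ) : ZMod (2 * l * δ i))) (hfg : f i ≠ g i) :
    ((2 * m : ℕ) : ℕ∞) ≤ (network (profile δ l r)).edist x y := by
  have hPi : (4 * m : ℤ) ≤ 2 * l * δ i := by exact_mod_cast hP i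
  refine le_edist_of_coord_intCast hl x y i (2 * m) (2 * m * sign (f i)) ?_ ?_ ?_
  · rw [hx, hy, add_sub_add_left_eq_sub, ← Int.cast_sub, sign_eq_neg hfg]
    congr 1
    ring
  · rw [abs_mul_sign, abs_of_nonneg (by positivity)]
    push_cast
    exact le_rfl
  · rw [abs_mul_sign, abs_of_nonneg (by positivity)]
    push_cast
    linarith

/-- A player without edges cannot drop any, so only the counting arguments are needed. -/
theorem robust_of_rays {α : ℝ} {k : ℕ} (hl : 2 ≤ l) (hlk : l ≤ k) (hα : 1 < α)
    (hlα : (l : ℝ) ≤ α + 1) (hcard : (k : ℝ) ≤ α * (2 ^ d - 2) + 1)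
    (hP : ∀ i, 4 * k + 4 * l ≤ 2 * l * δ i) (i₀ : Fin d) {u : Node δ l r}
    (hu : (profile δ l r u).1 = ∅) (x : (Fin d → Bool) → Node δ l r)
    (hx : ∀ f i, coord (x f) i = coord u i + ((k * sign (f i) : ℤ) : ZMod (2 * l * δ i)))
    (hle : ∀ f, (network (profile δ l r)).edist u (x f) ≤ k) :
    Robust α k (profile δ l r) u := by
  intro S
  refine unprofitable_of_card_le hl hlk hα hlα hcard x (fun f => le_antisymm (hle f) ?_)
    (fun f g hfg => ?_) (by simp [hu]) i₀.pos (by simp [hu])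
  · rw [SimpleGraph.edist_comm]
    have hPi : (4 * k + 4 * l : ℤ) ≤ 2 * l * δ i₀ := by exact_mod_cast hP i₀
    refine le_edist_of_coord_intCast hl (x f) u i₀ k (k * sign (f i₀)) ?_ ?_ ?_
    · rw [hx, add_sub_cancel_left]
    · rw [abs_mul_sign, abs_of_nonneg (by positivity)]
    · rw [abs_mul_sign, abs_of_nonneg (by positivity)]
      linarith
  · obtain ⟨i, hi⟩ := Function.ne_iff.1 hfg
    refine le_trans ?_ (le_edist_corners hl (m := k) (fun i => by have := hP i; omega) f g
      (coord u) (hx f i) (hx g i) hi)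
    exact_mod_cast (by omega : 2 * (k - 1) ≤ 2 * k)

theorem robust_even {α : ℝ} {k : ℕ} (hl : 2 ≤ l) (hlk : l ≤ k) (hα : 1 < α)
    (hlα : (l : ℝ) ≤ α + 1) (hcard : (k : ℝ) ≤ α * (2 ^ d - 2) + 1)
    (hP : ∀ i, 4 * k + 4 * l ≤ 2 * l * δ i) (i₀ : Fin d) (a : ∀ i, ZMod (δ i)) :
    Robust α k (profile δ l r) (even a) := by
  choose x hx hd using fun f => (exists_ray (r := r) hl f k).1 a
  exact robust_of_rays hl hlk hα hlα hcard hP i₀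
    (Finset.eq_empty_of_forall_notMem fun y hy => mem_profile.1 hy) x hx hd

theorem robust_odd {α : ℝ} {k : ℕ} (hl : 2 ≤ l) (hlk : l ≤ k) (hα : 1 < α)
    (hlα : (l : ℝ) ≤ α + 1) (hcard : (k : ℝ) ≤ α * (2 ^ d - 2) + 1)
    (hP : ∀ i, 4 * k + 4 * l ≤ 2 * l * δ i) (i₀ : Fin d) (b : ∀ i, ZMod (δ i)) :
    Robust α k (profile δ l r) (odd b) := by
  choose x hx hd using fun f => (exists_ray (r := r) hl f k).2 b
  refine robust_of_rays hl hlk hα hlα hcard hP i₀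
    (Finset.eq_empty_of_forall_notMem fun y hy => mem_profile.1 hy) x (fun f i => ?_) hd
  rw [hx, Int.cast_add, ← add_assoc]
  rfl

/-- The leaf spends one step to reach `odd 0`, so its corners lie only `k - 1` from there and are
just `2 * (k - 1)` apart. -/
theorem robust_leaf {α : ℝ} {k : ℕ} (hl : 2 ≤ l) (hlk : l ≤ k) (hα : 1 < α)
    (hlα : (l : ℝ) ≤ α + 1) (hcard : (k : ℝ) ≤ α * (2 ^ d - 2) + 1)
    (hP : ∀ i, 4 * k + 4 * l ≤ 2 * l * δ i) (i₀ : Fin d) (y : Fin r) :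
    Robust α k (profile δ l r) (leaf y) := by
  classical
  intro S
  choose x hx hd using fun f => (exists_ray (δ := δ) (r := r) hl f (k - 1)).2 0
  have hPi : (4 * k + 4 * l : ℤ) ≤ 2 * l * δ i₀ := by exact_mod_cast hP i₀
  have hc : ∀ f i, coord (x f) i = coord (odd 0 : Node δ l r) i +
      (((k - 1 : ℕ) * sign (f i) : ℤ) : ZMod (2 * l * δ i)) := by
    intro f i
    rw [hx, Int.cast_add, ← add_assoc]
    rfl
  have hcn : ∀ f, k - 1 ≤ cyclicNorm (coord (x f) i₀ - coord (odd 0 : Node δ l r) i₀) := by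
    intro f
    rw [hc, add_sub_cancel_left]
    refine cyclicNorm_intCast_ge _ _ ?_ ?_ <;> rw [abs_mul_sign, abs_of_nonneg (by positivity)]
    push_cast [Nat.cast_sub (show 1 ≤ k by omega)]
    linarith
  have hx' : ∀ f, (network (profile δ l r)).edist (leaf y) (x f) = k := by
    intro f
    refine le_antisymm ?_ ?_
    · have := edist_triangle_le (edist_le_one_of_adj (adj_leaf (l := l) (δ := δ) y)) (hd f)
      rwa [show 1 + (k - 1) = k by omega] at this
    · have hne : x f ≠ leaf y := by
        intro h
        have := hcn f
        rw [h] at this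
        simp only [coord, Pi.zero_apply, sub_self, cyclicNorm_zero] at this
        omega
      -- A leaf shares the coordinates of `odd 0`; the value `-1` recovers the step between them.
      refine le_edist_of_potential _ (fun v => if v = leaf y then -1 else
        (cyclicNorm (coord v i₀ - coord (odd 0 : Node δ l r) i₀) : ℤ)) ?_ _ _ _ ?_
      · intro v w hvw
        by_cases hv : v = leaf y <;> by_cases hw : w = leaf y
        · simp [hv, hw]
        · subst hv
          rcases hvw with h | h
          · rw [profile_leaf, Finset.mem_singleton] at h
            subst h
            simp [cyclicNorm_zero]
          · exact absurd h (leaf_notMem_profile y w)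
        · simp only [hv, hw, if_true, if_false]
          omega
        · simp only [hv, hw, if_false]
          exact_mod_cast cyclicNorm_coord_le hl hvw i₀ _
      · simp only [hne, if_true, if_false]
        have := hcn f
        omega
  have hcard1 : (profile δ l r (leaf y)).1.card = 1 := by simp [profile_leaf]
  by_cases hS : S.1 = ∅
  · exact unprofitable_of_isolated (by omega) (leaf_notMem_profile y) hS (hx' fun _ => true)
  · refine unprofitable_of_card_le hl hlk hα hlα hcard x hx' (fun f g hfg => ?_) hcard1.le
      i₀.pos ?_
    · obtain ⟨i, hi⟩ := Function.ne_iff.1 hfg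
      exact le_edist_corners hl (m := k - 1) (fun i => by have := hP i; omega) f g
        (coord (odd 0)) (hc f i) (hc g i) hi
    · rw [hcard1]
      exact Finset.card_pos.2 (Finset.nonempty_iff_ne_empty.2 hS)

end Node

/-! ### Inner nodes: corners and the detour around a cut -/

namespace Node

variable {d : ℕ} {δ : Fin d → ℕ} {l r : ℕ}

theorem mem_profile_inner {a : ∀ i, ZMod (δ i)} {e : Fin d → Bool} {t : Fin (l - 1)}
    {w : Node δ l r} (h : inner a e t ∈ (profile δ l r w).1) :
    ∃ t' : Fin (l - 1), t'.1 + 1 = t.1 ∧ w = inner a e t' := by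
  rw [mem_profile] at h
  rcases w with a' | b | ⟨a', f, t'⟩ | i
  · exact h.elim
  · exact h.elim
  · rcases h with h | ⟨_, h⟩
    · obtain ⟨rfl, rfl, h⟩ := along_eq_inner.1 h.symm
      exact ⟨t', by omega, rfl⟩
    · cases h
  · change inner a e t = odd 0 at h
    cases h

theorem card_profile_inner_of_pos {a : ∀ i, ZMod (δ i)} {e : Fin d → Bool} {t : Fin (l - 1)}
    (ht : t.1 ≠ 0) : (profile δ l r (inner a e t)).1.card = 1 := by
  rw [Finset.card_eq_one]
  refine ⟨along a e (t.1 + 2), ?_⟩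
  ext v
  rw [mem_profile, Finset.mem_singleton]
  constructor
  · rintro (h | ⟨h, _⟩)
    · exact h
    · exact absurd h ht
  · exact Or.inl

theorem card_profile_inner_zero {a : ∀ i, ZMod (δ i)} {e : Fin d → Bool} {t : Fin (l - 1)}
    (ht : t.1 = 0) : (profile δ l r (inner a e t)).1.card = 2 := by
  classical
  have hne : (along a e (t.1 + 2) : Node δ l r) ≠ even a := by
    rw [along, if_neg (by omega)]
    split_ifs <;> exact fun h => nomatch h
  rw [← Finset.card_pair hne]
  congr 1
  ext v
  rw [mem_profile]
  simp only [Finset.mem_insert, Finset.mem_singleton]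
  constructor
  · rintro (h | ⟨_, h⟩)
    · exact Or.inl h
    · exact Or.inr h
  · rintro (h | h)
    · exact Or.inl h
    · exact Or.inr ⟨ht, h⟩

/-- The position of the far end of the straight line in direction `f` through one of the ends of
the path on which an inner node lies; which end it is depends on the sign `f i₀`. -/
def cornerShift (k l t : ℕ) (i₀ : Fin d) (e f : Fin d → Bool) (i : Fin d) : ℤ :=
  if f i₀ = e i₀ then l * sign (e i) + (k + t - l : ℤ) * sign (f i) else (k - t : ℤ) * sign (f i)

theorem exists_corners (hl : 2 ≤ l) {k : ℕ} (hlk : l ≤ k) (i₀ : Fin d) (a : ∀ i, ZMod (δ i))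
    (e : Fin d → Bool) (t : Fin (l - 1)) : ∃ x : (Fin d → Bool) → Node δ l r,
      ∀ f, (network (profile δ l r)).edist (inner a e t) (x f) ≤ k ∧
        ∀ i, coord (x f) i = stretch l (δ i) (a i) +
          (cornerShift k l (t.1 + 1) i₀ e f i : ZMod (2 * l * δ i)) := by
  refine Classical.axiom_of_choice (r := fun f x =>
    (network (profile δ l r)).edist (inner a e t) x ≤ k ∧
        ∀ i, coord x i = stretch l (δ i) (a i) +
          (cornerShift k l (t.1 + 1) i₀ e f i : ZMod (2 * l * δ i))) fun f => ?_
  have ht := t.2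
  by_cases hf : f i₀ = e i₀
  · obtain ⟨x, hx, hd⟩ := (exists_ray (r := r) hl f (k + (t.1 + 1) - l)).2 (shift a e)
    refine ⟨x, ?_, fun i => ?_⟩
    · have h1 := edist_along_le (r := r) hl a e (t.1 + 1) (l - (t.1 + 1)) (by omega)
      rw [along_inner, show t.1 + 1 + (l - (t.1 + 1)) = l by omega, along_last hl] at h1
      have h2 := edist_triangle_le h1 hd
      rwa [show l - (t.1 + 1) + (k + (t.1 + 1) - l) = k by omega] at h2
    · rw [hx, stretch_shift, add_assoc, ← Int.cast_add, cornerShift, if_pos hf,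
        Nat.cast_sub (show l ≤ k + (t.1 + 1) by omega)]
      push_cast
      ring
  · obtain ⟨x, hx, hd⟩ := (exists_ray (r := r) hl f (k - (t.1 + 1))).1 a
    refine ⟨x, ?_, fun i => ?_⟩
    · have h1 := edist_along_le (r := r) hl a e 0 (t.1 + 1) (by omega)
      rw [zero_add, along_inner, along_zero, SimpleGraph.edist_comm] at h1
      have h2 := edist_triangle_le h1 hd
      rwa [show t.1 + 1 + (k - (t.1 + 1)) = k by omega] at h2
    · rw [hx, cornerShift, if_neg hf, Nat.cast_sub (show t.1 + 1 ≤ k by omega)]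

/-- The cut-off part of the star around `even a`: the nodes on the paths that start there, except
those beyond the inner node number `t` in direction `e`. -/
def Near (a : ∀ i, ZMod (δ i)) (e : Fin d → Bool) (t : Fin (l - 1)) : Node δ l r → Prop
  | even a' => a' = a
  | odd _ => False
  | inner a' f s => a' = a ∧ (f ≠ e ∨ s ≤ t)
  | leaf _ => False

theorem near_along (hl : 2 ≤ l) {a a' : ∀ i, ZMod (δ i)} {e f : Fin d → Bool} {t : Fin (l - 1)}
    {s : ℕ} (hs : s ≤ l) : Near a e t (along a' f s : Node δ l r) ↔
      a' = a ∧ s < l ∧ (s = 0 ∨ f ≠ e ∨ s ≤ t.1 + 1) := by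
  by_cases h0 : s = 0
  · subst h0
    simp [along_zero, Near, show 0 < l by omega]
  · by_cases h1 : s - 1 < l - 1
    · rw [along_of_lt a' f h0 h1]
      simp only [Near, Fin.le_def]
      have h2 : s - 1 ≤ t.1 ↔ s ≤ t.1 + 1 := by omega
      have h3 : s < l := by omega
      simp [h0, h2, h3]
    · obtain rfl : s = l := by omega
      rw [along_last hl]
      simp [Near]

open Classical in
/-- A potential that shows that it is a long way round from the cut-off star around `even a` to
the other side of the cut. -/
def detour (a : ∀ i, ZMod (δ i)) (e : Fin d → Bool) (t : Fin (l - 1)) (i₀ : Fin d)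
    (v : Node δ l r) : ℕ :=
  if Near a e t v then 0 else Finset.univ.inf' ⟨i₀, Finset.mem_univ i₀⟩ fun i =>
    cyclicNorm (coord v i - (stretch l (δ i) (a i) - ((l * sign (e i) : ℤ) : ZMod (2 * l * δ i))))

theorem detour_of_near {a : ∀ i, ZMod (δ i)} {e : Fin d → Bool} {t : Fin (l - 1)} (i₀ : Fin d)
    {v : Node δ l r} (h : Near a e t v) : detour a e t i₀ v = 0 := by
  simp [detour, h]

variable [∀ i, NeZero (δ i)]

theorem cyclicNorm_lt_of_near (hl : 2 ≤ l) {a : ∀ i, ZMod (δ i)} {e : Fin d → Bool}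
    {t : Fin (l - 1)} {v : Node δ l r} (h : Near a e t v) (i : Fin d) :
    cyclicNorm (coord v i - stretch l (δ i) (a i)) < l := by
  have : NeZero (2 * l * δ i) := ⟨by have := NeZero.ne (δ i); positivity⟩
  rcases v with a' | b | ⟨a', f, s⟩ | j
  · obtain rfl : a' = a := h
    simp [coord, cyclicNorm_zero]
    omega
  · exact h.elim
  · obtain ⟨rfl, _⟩ := h
    simp only [coord, add_sub_cancel_left]
    refine (cyclicNorm_intCast_le _).trans_lt ?_
    have := s.2
    rcases sign_cases (f i) with h | h <;> rw [h] <;> omega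
  · exact h.elim

/-- Once the path in direction `e` is cut, the star can be left only through the end of a path in
some direction `f ≠ e`. Where `f` and `e` differ, that end has exactly the reference coordinate, so
the minimum over all coordinates vanishes there and joins the value `0` on the star without a jump.
-/
theorem detour_lipschitz (hl : 2 ≤ l) {a : ∀ i, ZMod (δ i)} {e : Fin d → Bool} {t : Fin (l - 1)}
    (i₀ : Fin d) {v w : Node δ l r} (hv : v ≠ inner a e t) (hw : w ≠ inner a e t)
    (h : (network (profile δ l r)).Adj v w) : detour a e t i₀ w ≤ detour a e t i₀ v + 1 := by
  have hfar : ∀ v w : Node δ l r, (network (profile δ l r)).Adj v w → ¬ Near a e t v →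
      ¬ Near a e t w → detour a e t i₀ w ≤ detour a e t i₀ v + 1 := by
    intro v w h h1 h2
    simp only [detour, h1, h2, if_false]
    obtain ⟨i, hi, hmin⟩ := Finset.exists_mem_eq_inf' ⟨i₀, Finset.mem_univ i₀⟩ fun i =>
      cyclicNorm (coord v i - (stretch l (δ i) (a i) -
        ((l * sign (e i) : ℤ) : ZMod (2 * l * δ i))))
    rw [hmin]
    exact (Finset.inf'_le _ hi).trans (cyclicNorm_coord_le hl h i _)
  have key : ∀ a' f s, s < l → (along a' f s : Node δ l r) ≠ inner a e t →
      (Near a e t (along a' f s : Node δ l r) ↔ Near a e t (along a' f (s + 1) : Node δ l r)) ∨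
      (detour a e t i₀ (along a' f s : Node δ l r) = 0 ∧
        detour a e t i₀ (along a' f (s + 1) : Node δ l r) = 0) := by
    intro a' f s hs hne
    rw [Ne, along_eq_inner] at hne
    have ht := t.2
    by_cases hc : a' = a ∧ f ≠ e ∧ s + 1 = l
    · right
      obtain ⟨rfl, hfe, hs1⟩ := hc
      refine ⟨detour_of_near i₀ ((near_along hl hs.le).2 ⟨rfl, hs, Or.inr (Or.inl hfe)⟩), ?_⟩
      have hn : ¬ Near a' e t (along a' f (s + 1) : Node δ l r) := by
        rw [near_along hl hs]
        omega
      obtain ⟨i, hi⟩ := Function.ne_iff.1 hfe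
      simp only [detour, hn, if_false]
      refine Nat.le_zero.1 ((Finset.inf'_le _ (Finset.mem_univ i)).trans ?_)
      rw [hs1, coord_along hl a' f le_rfl, sign_eq_neg hi]
      simp [cyclicNorm_zero]
    · left
      rw [near_along hl hs.le, near_along hl hs]
      by_cases ha : a' = a
      · by_cases hf : f = e
        · simp only [ha, hf, true_and, ne_eq, not_true, false_or] at hne ⊢
          omega
        · simp only [ha, hf, true_and, ne_eq, not_false_iff, true_or, or_true, and_true] at hc ⊢
          omega
      · simp [ha]
  by_cases hvn : Near a e t v
  · by_cases hwn : Near a e t w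
    · rw [detour_of_near i₀ hwn]
      omega
    · rcases adj_cases hl h with ⟨a', f, s, hs, ⟨rfl, rfl⟩ | ⟨rfl, rfl⟩⟩ |
        ⟨j, ⟨rfl, rfl⟩ | ⟨rfl, rfl⟩⟩
      · rcases key a' f s hs hv with h' | h'
        · exact absurd (h'.1 hvn) hwn
        · omega
      · rcases key a' f s hs hw with h' | h'
        · exact absurd (h'.2 hvn) hwn
        · omega
      · exact hvn.elim
      · exact hvn.elim
  · by_cases hwn : Near a e t w
    · rw [detour_of_near i₀ hwn]
      omega
    · exact hfar v w h hvn hwn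

/-- The node opposite to `even a`, seen from an inner node of a path that starts there, is far
from the cut-off star. -/
theorem le_detour (hl : 2 ≤ l) {k : ℕ} (hP : ∀ i, 4 * k + 4 * l ≤ 2 * l * δ i)
    {a : ∀ i, ZMod (δ i)} {e : Fin d → Bool} {t : Fin (l - 1)} (hlk : l ≤ k)
    (i₀ : Fin d) {x : Node δ l r} (hx : ∀ i, coord x i = stretch l (δ i) (a i) +
      (((k + t.1 + 1 : ℕ) * sign (e i) : ℤ) : ZMod (2 * l * δ i))) :
    k + l ≤ detour a e t i₀ x := by
  have ht := t.2
  have hn : ¬ Near a e t x := by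
    intro h
    have h1 := cyclicNorm_lt_of_near hl h i₀
    have hPi : (4 * k + 4 * l : ℤ) ≤ 2 * l * δ i₀ := by exact_mod_cast hP i₀
    have h2 : l ≤ cyclicNorm (coord x i₀ - stretch l (δ i₀) (a i₀)) := by
      rw [hx, add_sub_cancel_left]
      refine cyclicNorm_intCast_ge _ _ ?_ ?_ <;>
        rw [abs_mul_sign, abs_of_nonneg (by positivity)] <;> push_cast <;> omega
    omega
  simp only [detour, hn, if_false]
  refine Finset.le_inf' _ _ fun i _ => ?_
  have hPi : (4 * k + 4 * l : ℤ) ≤ 2 * l * δ i := by exact_mod_cast hP i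
  rw [hx, add_sub_sub_cancel, ← Int.cast_add, ← add_mul]
  refine cyclicNorm_intCast_ge _ _ ?_ ?_ <;>
    rw [abs_mul_sign, abs_of_nonneg (by positivity)] <;> push_cast <;> omega

end Node

/-- The only edge left at `u` leads to `s`, so `u` can be given the value `φ s - 1` whatever its old
neighbours are. -/
theorem le_edist_deviate_singleton {V : Type} {σ : Profile V} {u s : V}
    {S : {S : Finset V // u ∉ S}} (hS : S.1 = {s}) (hu : ∀ w, u ∉ (σ w).1) (φ : V → ℤ)
    (h : ∀ v w, v ≠ u → w ≠ u → (network σ).Adj v w → φ w ≤ φ v + 1) {x : V} (hx : x ≠ u) (N : ℕ)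
    (hN : (N : ℤ) ≤ φ x - φ s + 1) : (N : ℕ∞) ≤ (network (deviate σ u S)).edist u x := by
  classical
  have hsu : s ≠ u := by
    rintro rfl
    exact S.2 (by simp [hS])
  refine le_edist_deviate (fun v => if v = u then φ s - 1 else φ v) ?_ ?_ x N ?_
  · intro v w hv hw hvw
    simpa [hv, hw] using h v w hv hw hvw
  · rintro w (hw | hw)
    · rw [hS, Finset.mem_singleton] at hw
      subst hw
      simp only [hsu, if_true, if_false]
      omega
    · exact absurd hw (hu w)
  · simp only [hx, if_true, if_false]
    omega

/-! ### Inner nodes cannot improve -/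

namespace Node

theorem abs_add_mul_sign {c m : ℤ} {b : Bool} (hc : 0 ≤ c * sign b) (hm : 0 ≤ m) :
    |c + m * sign b| = |c| + m := by
  rcases sign_cases b with h | h <;> rw [h] at hc ⊢
  · rw [abs_of_nonneg (by linarith), abs_of_nonneg (by linarith), mul_one]
  · rw [abs_of_nonpos (by linarith), abs_of_nonpos (by linarith)]
    ring

/-- Every integer in the class has the form `2lp + m`. Either `p ≠ 0` and `|m| < l`, or `m = l` and
the integer is an odd multiple of `l`. -/
theorem le_abs_valMinAbs_stretch {l δ : ℕ} [NeZero δ] (z : ZMod δ) (m : ℤ)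
    (h : (z ≠ 0 ∧ |m| < l) ∨ m = l) :
    (l : ℤ) ≤ |(stretch l δ z + (m : ZMod (2 * l * δ))).valMinAbs| := by
  obtain ⟨y, rfl⟩ := ZMod.intCast_surjective z
  have hcast : (((stretch l δ y + (m : ZMod (2 * l * δ))).valMinAbs : ℤ) : ZMod (2 * l * δ))
      = ((2 * l * y + m : ℤ) : ZMod (2 * l * δ)) := by
    rw [ZMod.coe_valMinAbs, stretch_intCast, ← Int.cast_add]
  generalize (stretch l δ y + (m : ZMod (2 * l * δ))).valMinAbs = v at hcast ⊢
  rw [ZMod.intCast_eq_intCast_iff_dvd_sub] at hcast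
  obtain ⟨q, hq⟩ := hcast
  push_cast at hq
  have hv : v = 2 * l * (y - δ * q) + m := by linear_combination -hq
  rcases h with ⟨hz, hm⟩ | rfl
  · have hne : y - δ * q ≠ 0 := by
      intro h0
      apply hz
      rw [ZMod.intCast_zmod_eq_zero_iff_dvd]
      exact ⟨q, by linarith⟩
    generalize y - δ * q = p at hv hne
    rw [hv]
    rw [abs_lt] at hm
    rcases lt_or_gt_of_ne hne with hp | hp
    · rw [le_abs]
      right
      nlinarith
    · rw [le_abs]
      left
      nlinarith
  · generalize y - δ * q = p at hv
    rw [hv, le_abs]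
    rcases lt_or_ge p 0 with hp | hp
    · right
      nlinarith
    · left
      nlinarith

variable {d : ℕ} {δ : Fin d → ℕ} {l r : ℕ}

theorem coord_corner_self {k : ℕ} {i₀ : Fin d} {a : ∀ i, ZMod (δ i)} {e : Fin d → Bool}
    {t : Fin (l - 1)} {x : (Fin d → Bool) → Node δ l r}
    (hc : ∀ f i, coord (x f) i = stretch l (δ i) (a i) +
      (cornerShift k l (t.1 + 1) i₀ e f i : ZMod (2 * l * δ i))) (i : Fin d) :
    coord (x e) i = stretch l (δ i) (a i) +
      (((k + t.1 + 1 : ℕ) * sign (e i) : ℤ) : ZMod (2 * l * δ i)) := by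
  rw [hc, cornerShift, if_pos rfl]
  congr 2
  push_cast
  ring

theorem coord_corner_not {k : ℕ} {i₀ : Fin d} {a : ∀ i, ZMod (δ i)} {e : Fin d → Bool}
    {t : Fin (l - 1)} {x : (Fin d → Bool) → Node δ l r}
    (hc : ∀ f i, coord (x f) i = stretch l (δ i) (a i) +
      (cornerShift k l (t.1 + 1) i₀ e f i : ZMod (2 * l * δ i))) (i : Fin d) :
    coord (x fun i => !e i) i = stretch l (δ i) (a i) +
      ((-((k - (t.1 + 1) : ℤ) * sign (e i)) : ℤ) : ZMod (2 * l * δ i)) := by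
  rw [hc, cornerShift, if_neg (by simp), sign_not]
  congr 2
  push_cast
  ring

variable [∀ i, NeZero (δ i)]

/-- A node is in the star around `even a` if all of its coordinates are close. -/
theorem exists_far_coord (hl : 2 ≤ l) (i₀ : Fin d) (a : ∀ i, ZMod (δ i)) (v : Node δ l r)
    (h1 : v ≠ even a) (h2 : ∀ f t, v ≠ inner a f t) :
    ∃ i, (l : ℤ) ≤ |(coord v i - stretch l (δ i) (a i)).valMinAbs| := by
  rcases v with a' | b | ⟨a', f, t⟩ | j
  · obtain ⟨i, hi⟩ := Function.ne_iff.1 (fun h => h1 (by rw [h]) : a' ≠ a)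
    refine ⟨i, ?_⟩
    have := le_abs_valMinAbs_stretch (l := l) (a' i - a i) 0
      (Or.inl ⟨sub_ne_zero.2 hi, by simp; omega⟩)
    simpa [coord, map_sub] using this
  · refine ⟨i₀, ?_⟩
    have := le_abs_valMinAbs_stretch (l := l) (b i₀ - a i₀) l (Or.inr rfl)
    rw [map_sub] at this
    simpa only [coord, add_sub_right_comm] using this
  · obtain ⟨i, hi⟩ := Function.ne_iff.1 (fun h => h2 f t (by rw [h]) : a' ≠ a)
    refine ⟨i, ?_⟩
    have ht := t.2
    have := le_abs_valMinAbs_stretch (l := l) (a' i - a i) ((t.1 + 1 : ℕ) * sign (f i))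
      (Or.inl ⟨sub_ne_zero.2 hi, by rw [abs_mul_sign, abs_of_nonneg (by positivity)]; omega⟩)
    rw [map_sub] at this
    simpa only [coord, add_sub_right_comm] using this
  · refine ⟨i₀, ?_⟩
    have := le_abs_valMinAbs_stretch (l := l) (0 - a i₀) l (Or.inr rfl)
    rw [map_sub] at this
    simpa only [coord, add_sub_right_comm] using this

section Inner

variable {α : ℝ} {k : ℕ} {i₀ : Fin d} {a : ∀ i, ZMod (δ i)} {e : Fin d → Bool}
  {t : Fin (l - 1)} {x : (Fin d → Bool) → Node δ l r}

/-- The sign `f i₀` selects the end through which the line leaves the path, so that coordinate `i₀`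
moves monotonically and changes by exactly `k`. -/
theorem edist_corner (hl : 2 ≤ l) (hlk : l ≤ k) (hP : ∀ i, 4 * k + 4 * l ≤ 2 * l * δ i)
    {f : Fin d → Bool} {x : Node δ l r}
    (hd : (network (profile δ l r)).edist (inner a e t) x ≤ k)
    (hc : ∀ i, coord x i = stretch l (δ i) (a i) +
      (cornerShift k l (t.1 + 1) i₀ e f i : ZMod (2 * l * δ i))) :
    (network (profile δ l r)).edist (inner a e t) x = k := by
  refine le_antisymm hd ?_
  have hPi : (4 * k + 4 * l : ℤ) ≤ 2 * l * δ i₀ := by exact_mod_cast hP i₀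
  rw [SimpleGraph.edist_comm]
  refine le_edist_of_coord_intCast hl x (inner a e t) i₀ k (k * sign (f i₀)) ?_ ?_ ?_
  · rw [hc]
    simp only [coord]
    rw [add_sub_add_left_eq_sub, ← Int.cast_sub]
    congr 1
    unfold cornerShift
    split_ifs with h
    · rw [h]
      push_cast
      ring
    · rw [sign_eq_neg h]
      push_cast
      ring
  · rw [abs_mul_sign, abs_of_nonneg (by positivity)]
  · rw [abs_mul_sign, abs_of_nonneg (by positivity)]
    linarith

/-- Corners reached through different ends differ by `2k` in coordinate `i₀`. Corners reached
through the same end are only twice their distance to that end apart, hence the hypotheses `hp` and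
`hq`. -/
theorem le_edist_corner_corner (hl : 2 ≤ l) (hlk : l ≤ k)
    (hP : ∀ i, 4 * k + 4 * l ≤ 2 * l * δ i)
    (hc : ∀ f i, coord (x f) i = stretch l (δ i) (a i) +
      (cornerShift k l (t.1 + 1) i₀ e f i : ZMod (2 * l * δ i)))
    {f g : Fin d → Bool} (hfg : f ≠ g) {N : ℕ} (hN : N ≤ 2 * k)
    (hp : f i₀ = e i₀ → g i₀ = e i₀ → N ≤ 2 * (k + t.1 + 1 - l))
    (hq : f i₀ ≠ e i₀ → g i₀ ≠ e i₀ → N ≤ 2 * (k - (t.1 + 1))) :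
    (N : ℕ∞) ≤ (network (profile δ l r)).edist (x f) (x g) := by
  have ht := t.2
  by_cases hf : f i₀ = e i₀ <;> by_cases hg : g i₀ = e i₀
  · obtain ⟨i, hi⟩ := Function.ne_iff.1 hfg
    have := hP i
    have h1 := le_edist_corners (r := r) hl (m := k + t.1 + 1 - l)
      (x := x f) (y := x g) (fun i => by have := hP i; omega) f g
      (fun i => stretch l (δ i) (a i) + ((l * sign (e i) : ℤ) : ZMod (2 * l * δ i))) (i := i)
      (by
        rw [hc, cornerShift, if_pos hf, add_assoc, ← Int.cast_add,
          Nat.cast_sub (show l ≤ k + t.1 + 1 by omega)]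
        push_cast
        ring)
      (by
        rw [hc, cornerShift, if_pos hg, add_assoc, ← Int.cast_add,
          Nat.cast_sub (show l ≤ k + t.1 + 1 by omega)]
        push_cast
        ring) hi
    refine le_trans ?_ h1
    exact_mod_cast hp hf hg
  · refine le_edist_of_coord_intCast hl (x f) (x g) i₀ N (2 * k * sign (e i₀)) ?_ ?_ ?_
    · rw [hc, hc, add_sub_add_left_eq_sub, ← Int.cast_sub, cornerShift, cornerShift, if_pos hf,
        if_neg hg, hf, sign_eq_neg hg]
      congr 1
      ring
    · rw [abs_mul_sign, abs_of_nonneg (by positivity)]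
      exact_mod_cast hN
    · rw [abs_mul_sign, abs_of_nonneg (by positivity)]
      have := hP i₀
      exact_mod_cast (by omega : 2 * k + N ≤ 2 * l * δ i₀)
  · refine le_edist_of_coord_intCast hl (x f) (x g) i₀ N (2 * k * sign (f i₀)) ?_ ?_ ?_
    · rw [hc, hc, add_sub_add_left_eq_sub, ← Int.cast_sub, cornerShift, cornerShift, if_neg hf,
        if_pos hg, hg, sign_eq_neg hf]
      congr 1
      ring
    · rw [abs_mul_sign, abs_of_nonneg (by positivity)]
      exact_mod_cast hN
    · rw [abs_mul_sign, abs_of_nonneg (by positivity)]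
      have := hP i₀
      exact_mod_cast (by omega : 2 * k + N ≤ 2 * l * δ i₀)
  · obtain ⟨i, hi⟩ := Function.ne_iff.1 hfg
    have h1 := le_edist_corners (r := r) hl (m := k - (t.1 + 1))
      (x := x f) (y := x g) (fun i => by have := hP i; omega) f g
      (fun i => stretch l (δ i) (a i)) (i := i)
      (by rw [hc, cornerShift, if_neg hf, Nat.cast_sub (show t.1 + 1 ≤ k by omega)])
      (by rw [hc, cornerShift, if_neg hg, Nat.cast_sub (show t.1 + 1 ≤ k by omega)]) hi
    refine le_trans ?_ h1
    exact_mod_cast hq hf hg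

/-- More edges than before do not pay off. -/
theorem unprofitable_inner_of_lt (hl : 2 ≤ l) (hlk : l ≤ k) (hα : 1 < α)
    (hlα : (l : ℝ) ≤ α + 1) (hcard : (k : ℝ) ≤ α * (2 ^ d - 2) + 1)
    (hP : ∀ i, 4 * k + 4 * l ≤ 2 * l * δ i)
    (hd : ∀ f, (network (profile δ l r)).edist (inner a e t) (x f) = k)
    (hc : ∀ f i, coord (x f) i = stretch l (δ i) (a i) +
      (cornerShift k l (t.1 + 1) i₀ e f i : ZMod (2 * l * δ i)))
    {S : {S : Finset (Node δ l r) // inner a e t ∉ S}}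
    (hu : (profile δ l r (inner a e t)).1.card ≤ 2)
    (hS : (profile δ l r (inner a e t)).1.card < S.1.card) :
    Unprofitable α k (profile δ l r) (inner a e t) S := by
  have ht := t.2
  refine unprofitable_of_card_lt (by linarith) (by omega) hlk hlα x hd (fun f g hfg => ?_) ?_ hS
  · exact le_edist_corner_corner hl hlk hP hc hfg (by omega) (fun _ _ => by omega)
      (fun _ _ => by omega)
  · rw [Fintype.card_fun, Fintype.card_bool, Fintype.card_fin]
    have hu' : ((profile δ l r (inner a e t)).1.card : ℝ) ≤ 2 := by exact_mod_cast hu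
    push_cast
    nlinarith

theorem robust_inner_of_pos (hl : 2 ≤ l) (hlk : l ≤ k) (hα : 1 < α) (hαl : α ≤ l)
    (hlα : (l : ℝ) ≤ α + 1) (hcard : (k : ℝ) ≤ α * (2 ^ d - 2) + 1)
    (hP : ∀ i, 4 * k + 4 * l ≤ 2 * l * δ i) (i₀ : Fin d) (a : ∀ i, ZMod (δ i))
    (e : Fin d → Bool) (t : Fin (l - 1)) (ht : t.1 ≠ 0) :
    Robust α k (profile δ l r) (inner a e t) := by
  intro S
  obtain ⟨x, hx⟩ := exists_corners (r := r) hl hlk i₀ a e t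
  have hc := fun f => (hx f).2
  have hd := fun f => edist_corner hl hlk hP (hx f).1 (hc f)
  have hcard1 := card_profile_inner_of_pos (r := r) (a := a) (e := e) ht
  rcases lt_trichotomy S.1.card 1 with h | h | h
  · have hS : S.1 = ∅ := by
      rw [← Finset.card_eq_zero]
      omega
    -- Without her edge the player is still linked to the side of `even a`, and the other side is a
    -- detour away; the additional distance `l ≥ α` outweighs the saved edge.
    refine ⟨x e, k + l, hd e, ?_, ?_⟩
    · have hself : Near a e t (inner a e t : Node δ l r) := ⟨rfl, Or.inr le_rfl⟩
      refine le_edist_deviate (fun v => (detour a e t i₀ v : ℤ)) ?_ ?_ _ _ ?_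
      · intro v w hv hw hvw
        exact_mod_cast detour_lipschitz hl i₀ hv hw hvw
      · rintro w (hw | hw)
        · simp [hS] at hw
        · obtain ⟨t', ht', rfl⟩ := mem_profile_inner hw
          have hn : Near a e t (inner a e t' : Node δ l r) :=
            ⟨rfl, Or.inr (Fin.le_def.2 (by omega))⟩
          simp [detour_of_near i₀ hself, detour_of_near i₀ hn]
      · rw [detour_of_near i₀ hself]
        have := le_detour hl hP (e := e) (t := t) hlk i₀ (coord_corner_self hc)
        push_cast
        omega
    · rw [hcard1, hS]
      push_cast
      simp only [Finset.card_empty]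
      push_cast
      linarith
  · have hne : e ≠ fun i => !e i := fun h => by
      have := congrFun h i₀
      simp at this
    -- Two corners suffice against one edge; opposite directions use different ends of the path, so
    -- these are `2k` apart.
    refine unprofitable_of_card_eq (by omega) {e, fun i => !e i} x (fun f _ => hd f) ?_ ?_
      (hcard1.trans h.symm)
    · intro f hf g hg hfg
      refine le_edist_corner_corner hl hlk hP hc hfg (by omega) ?_ ?_ <;>
      · intro h1 h2
        exfalso
        simp only [Finset.mem_insert, Finset.mem_singleton] at hf hg
        rcases hf with rfl | rfl <;> rcases hg with rfl | rfl <;> simp at hfg h1 h2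
    · rw [h, Finset.card_pair hne]
      norm_num
  · exact unprofitable_inner_of_lt hl hlk hα hlα hcard hP hd hc (by omega) (by omega)

/-- As `u` is the first inner node, a route from `s` that avoids `u` must leave the path at its odd
end. That end differs by `k + l - 1` in coordinate `i₀` from the corner opposite to `e`; hence the
constant value of `ψ` on the whole path. -/
theorem exists_le_edist_of_leg (hl : 2 ≤ l) (hlk : l ≤ k)
    (hP : ∀ i, 4 * k + 4 * l ≤ 2 * l * δ i)
    (hc : ∀ f i, coord (x f) i = stretch l (δ i) (a i) +
      (cornerShift k l (t.1 + 1) i₀ e f i : ZMod (2 * l * δ i))) (ht : t.1 = 0)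
    {S : {S : Finset (Node δ l r) // inner a e t ∉ S}} {s : Node δ l r} (hS : S.1 = {s})
    (hiso : ∀ w, inner a e t ∉ (profile δ l r w).1) (hxu : ∀ f, x f ≠ inner a e t)
    (hleg : ∃ t', s = inner a e t') : ∃ f, ((k + l : ℕ) : ℕ∞) ≤
      (network (deviate (profile δ l r) (inner a e t) S)).edist (inner a e t) (x f) := by
  classical
  have hPi : (4 * k + 4 * l : ℤ) ≤ 2 * l * δ i₀ := by exact_mod_cast hP i₀
  have hy := coord_corner_not hc i₀
  rw [ht] at hy
  refine ⟨fun i => !e i, ?_⟩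
  generalize hyx : x (fun i => !e i) = y at hy
  have hyu : y ≠ inner a e t := hyx ▸ hxu _
  have hyleg : ¬ ∃ t', y = inner a e t' := by
    rintro ⟨t', rfl⟩
    have ht' := t'.2
    simp only [coord] at hy
    rw [add_right_inj, ← sub_eq_zero, ← Int.cast_sub] at hy
    have := cyclicNorm_intCast_ge (P := 2 * l * δ i₀)
      ((t'.1 + 1 : ℕ) * sign (e i₀) - -((k - (0 + 1 : ℕ)) * sign (e i₀))) 1 ?_ ?_
    · push_cast at this hy
      rw [hy, cyclicNorm_zero] at this
      omega
    · rw [sub_neg_eq_add, ← add_mul, abs_mul_sign, abs_of_nonneg (by push_cast; omega)]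
      push_cast
      omega
    · rw [sub_neg_eq_add, ← add_mul, abs_mul_sign, abs_of_nonneg (by push_cast; omega)]
      push_cast
      omega
  let ψ : Node δ l r → ℕ := fun v => if ∃ t', v = inner a e t' then k + l - 1 else
    min (k + l - 1) (cyclicNorm (coord v i₀ - coord y i₀))
  have hψle : ∀ v, ψ v ≤ k + l - 1 := by
    intro v
    simp only [ψ]
    split_ifs
    · exact le_rfl
    · exact min_le_left _ _
  have hψs : ψ s = k + l - 1 := by simp only [ψ, hleg, if_true]
  have hψy : ψ y = 0 := by simp [ψ, hyleg, cyclicNorm_zero]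
  refine le_edist_deviate_singleton hS hiso (fun v => -(ψ v : ℤ)) ?_ hyu _ ?_
  · intro v w hv hw hvw
    suffices ψ v ≤ ψ w + 1 by omega
    by_cases hwl : ∃ t', w = inner a e t'
    · have : ψ w = k + l - 1 := by simp only [ψ, hwl, if_true]
      have := hψle v
      omega
    · by_cases hvl : ∃ t', v = inner a e t'
      · have hge : k + l - 1 ≤ cyclicNorm (coord w i₀ - coord y i₀) := by
          obtain ⟨t', rfl⟩ := hvl
          have ht' := t'.2
          rcases adj_cases hl hvw with ⟨a', f, m, hm, ⟨h1, rfl⟩ | ⟨rfl, h1⟩⟩ |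
            ⟨j, ⟨h1, _⟩ | ⟨_, h1⟩⟩
          · obtain ⟨rfl, rfl, h1⟩ := along_eq_inner.1 h1.symm
            have hml : m + 1 = l := by
              by_contra hne
              exact hwl ⟨⟨m, by omega⟩, along_inner a' f ⟨m, by omega⟩⟩
            rw [coord_along hl _ _ hm, hy, add_sub_add_left_eq_sub, ← Int.cast_sub,
              sub_neg_eq_add, ← add_mul]
            refine cyclicNorm_intCast_ge _ _ ?_ ?_ <;>
              rw [abs_mul_sign, abs_of_nonneg (by push_cast; omega)] <;> push_cast <;> omega
          · obtain ⟨rfl, rfl, h1⟩ := along_eq_inner.1 h1.symm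
            by_cases hm0 : m = 0
            · exact absurd (by rw [show t' = t from Fin.ext (by omega)]) hv
            · exact absurd ⟨_, along_of_lt a' f hm0 (by omega)⟩ hwl
          · cases h1
          · cases h1
        have : ψ w = k + l - 1 := by
          simp only [ψ, hwl, if_false]
          exact min_eq_left hge
        have := hψle v
        omega
      · simp only [ψ, hwl, hvl, if_false]
        have := cyclicNorm_coord_le hl hvw.symm i₀ (coord y i₀)
        omega
  · rw [hψs, hψy]
    push_cast
    omega

/-- Some coordinate of `s` is at least `l` away from that of `even a`. The corner in direction `e`
or its opposite lies on the other side in this coordinate, at least `k - 1` beyond `even a`; the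
edge to `s` adds one. -/
theorem exists_le_edist_of_far (hl : 2 ≤ l) (hlk : l ≤ k)
    (hP : ∀ i, 4 * k + 4 * l ≤ 2 * l * δ i)
    (hc : ∀ f i, coord (x f) i = stretch l (δ i) (a i) +
      (cornerShift k l (t.1 + 1) i₀ e f i : ZMod (2 * l * δ i))) (ht : t.1 = 0)
    {S : {S : Finset (Node δ l r) // inner a e t ∉ S}} {s : Node δ l r} (hS : S.1 = {s})
    (hiso : ∀ w, inner a e t ∉ (profile δ l r w).1) (hxu : ∀ f, x f ≠ inner a e t)
    (h1 : s ≠ even a) (h2 : ∀ f t, s ≠ inner a f t) : ∃ f, ((k + l : ℕ) : ℕ∞) ≤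
      (network (deviate (profile δ l r) (inner a e t) S)).edist (inner a e t) (x f) := by
  obtain ⟨i, hi⟩ := exists_far_coord hl i₀ a s h1 h2
  have : NeZero (2 * l * δ i) := ⟨by have := NeZero.ne (δ i); positivity⟩
  have hPi : (4 * k + 4 * l : ℤ) ≤ 2 * l * δ i := by exact_mod_cast hP i
  have hs := ZMod.coe_valMinAbs (coord s i - stretch l (δ i) (a i))
  have hle := two_mul_abs_valMinAbs_le (coord s i - stretch l (δ i) (a i))
  push_cast at hle
  generalize (coord s i - stretch l (δ i) (a i)).valMinAbs = c at hi hs hle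
  have key : ∀ f, k + l - 1 ≤ cyclicNorm (coord s i - coord (x f) i) →
      ((k + l : ℕ) : ℕ∞) ≤
      (network (deviate (profile δ l r) (inner a e t) S)).edist (inner a e t) (x f) := by
    intro f hf
    refine le_edist_deviate_singleton hS hiso
      (fun v => -(cyclicNorm (coord v i - coord (x f) i) : ℤ)) ?_ (hxu f) _ ?_
    · intro v w _ _ hvw
      have := cyclicNorm_coord_le hl hvw.symm i (coord (x f) i)
      omega
    · rw [sub_self, cyclicNorm_zero]
      push_cast
      omega
  by_cases hsgn : 0 ≤ c * sign (e i)
  · refine ⟨fun i => !e i, key _ ?_⟩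
    rw [coord_corner_not hc, ← sub_sub, ← hs, ← Int.cast_sub, ht, sub_neg_eq_add]
    refine cyclicNorm_intCast_ge _ _ ?_ ?_ <;>
      rw [abs_add_mul_sign hsgn (by push_cast; omega)] <;> push_cast <;> omega
  · refine ⟨e, key _ ?_⟩
    have hsgn' : 0 ≤ c * sign (!e i) := by
      rw [sign_not]
      linarith
    rw [coord_corner_self hc, ← sub_sub, ← hs, ← Int.cast_sub, ht, sub_eq_add_neg, ← mul_neg,
      ← sign_not]
    refine cyclicNorm_intCast_ge _ _ ?_ ?_ <;>
      rw [abs_add_mul_sign hsgn' (by push_cast; omega)] <;> push_cast <;> omega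

/-- If only one edge is kept, its endpoint `s` is in the cut-off star, on the rest of the cut path,
or outside the star; in each case some corner recedes to distance `k + l`. -/
theorem robust_inner_zero (hl : 2 ≤ l) (hlk : l ≤ k) (hα : 1 < α) (hαl : α ≤ l)
    (hlα : (l : ℝ) ≤ α + 1) (hcard : (k : ℝ) ≤ α * (2 ^ d - 2) + 1)
    (hP : ∀ i, 4 * k + 4 * l ≤ 2 * l * δ i) (i₀ i₁ : Fin d) (hi : i₁ ≠ i₀)
    (a : ∀ i, ZMod (δ i)) (e : Fin d → Bool) (t : Fin (l - 1)) (ht : t.1 = 0) :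
    Robust α k (profile δ l r) (inner a e t) := by
  classical
  intro S
  obtain ⟨x, hx⟩ := exists_corners (r := r) hl hlk i₀ a e t
  have hc := fun f => (hx f).2
  have hd := fun f => edist_corner hl hlk hP (hx f).1 (hc f)
  have hcard2 := card_profile_inner_zero (r := r) (a := a) (e := e) ht
  have hiso : ∀ w, inner a e t ∉ (profile δ l r w).1 := by
    intro w hw
    obtain ⟨t', ht', _⟩ := mem_profile_inner hw
    omega
  have hxu : ∀ f, x f ≠ inner a e t := by
    intro f h
    have := hd f
    rw [h, SimpleGraph.edist_self] at this
    have : 0 = k := by exact_mod_cast this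
    omega
  rcases lt_trichotomy S.1.card 2 with h | h | h
  · by_cases h0 : S.1.card = 0
    · exact unprofitable_of_isolated (by omega) hiso (Finset.card_eq_zero.1 h0) (hd e)
    · obtain ⟨s, hS⟩ := Finset.card_eq_one.1 (by omega : S.1.card = 1)
      have hsu : s ≠ inner a e t := by
        rintro rfl
        exact S.2 (by simp [hS])
      suffices hsuff : ∃ f, ((k + l : ℕ) : ℕ∞) ≤
          (network (deviate (profile δ l r) (inner a e t) S)).edist (inner a e t) (x f) by
        obtain ⟨f, hf⟩ := hsuff
        refine ⟨x f, k + l, hd f, hf, ?_⟩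
        rw [hcard2, hS, Finset.card_singleton]
        push_cast
        linarith
      by_cases hnear : Near a e t s
      · refine ⟨e, le_edist_deviate_singleton hS hiso (fun v => (detour a e t i₀ v : ℤ)) ?_
          (hxu e) _ ?_⟩
        · intro v w hv hw hvw
          exact_mod_cast detour_lipschitz hl i₀ hv hw hvw
        · rw [detour_of_near i₀ hnear]
          have := le_detour hl hP (e := e) (t := t) hlk i₀ (coord_corner_self hc)
          push_cast
          omega
      · by_cases hleg : ∃ t', s = inner a e t'
        · obtain ⟨f, hf⟩ := exists_le_edist_of_leg hl hlk hP hc ht hS hiso hxu hleg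
          exact ⟨f, hf⟩
        · push Not at hleg
          refine exists_le_edist_of_far hl hlk hP hc ht hS hiso hxu ?_ ?_
          · rintro rfl
            exact hnear rfl
          · rintro f t' rfl
            by_cases hfe : f = e
            · exact hleg t' (by rw [hfe])
            · exact hnear ⟨rfl, Or.inl hfe⟩
  -- Two edges require three corners, and the third requires a second dimension `i₁`. Both `g` and
  -- `g'` leave through `even a`, one step away, which gives separation exactly `2 * (k - 1)` in the
  -- bound.
  · let g : Fin d → Bool := fun i => !e i
    let g' : Fin d → Bool := Function.update g i₁ (e i₁)
    have hg : g i₀ ≠ e i₀ := by simp [g]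
    have hg' : g' i₀ ≠ e i₀ := by simp [g', g, Function.update_of_ne hi.symm]
    have h1 : e ≠ g := fun h => hg (by rw [← h])
    have h2 : e ≠ g' := fun h => hg' (by rw [← h])
    have h3 : g ≠ g' := fun h => by
      have := congrFun h i₁
      simp [g, g'] at this
    refine unprofitable_of_card_eq (by omega) {e, g, g'} x (fun f _ => hd f) ?_ ?_
      (hcard2.trans h.symm)
    · intro f hf g₁ hg₁ hfg
      refine le_edist_corner_corner hl hlk hP hc hfg (by omega) (fun hf' hg₁' => ?_)
        (fun _ _ => by omega)
      exfalso
      simp only [Finset.mem_insert, Finset.mem_singleton] at hf hg₁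
      rcases hf with rfl | rfl | rfl
      · rcases hg₁ with rfl | rfl | rfl
        · exact hfg rfl
        · exact hg hg₁'
        · exact hg' hg₁'
      · exact hg hf'
      · exact hg' hf'
    · rw [h, Finset.card_eq_three.2 ⟨e, g, g', h1, h2, h3, rfl⟩]
      norm_num
  · exact unprofitable_inner_of_lt hl hlk hα hlα hcard hP hd hc hcard2.le (by omega)

end Inner

end Node

/-! ### Renaming the players -/

section Transfer

variable {V W : Type}

/-- Renaming the players of a profile. -/
def mapProfile (f : V ≃ W) (σ : Profile V) : Profile W :=
  fun w => ⟨(σ (f.symm w)).1.map f.toEmbedding, by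
    intro h
    obtain ⟨v, hv, hw⟩ := Finset.mem_map.1 h
    have hvw : f.symm w = v := (f.symm_apply_eq).2 hw.symm
    exact (σ (f.symm w)).2 (hvw ▸ hv)⟩

theorem mapProfile_apply (f : V ≃ W) (σ : Profile V) (v : V) :
    (mapProfile f σ (f v)).1 = (σ v).1.map f.toEmbedding := by
  have key : ∀ u, u = v → (σ u).1.map f.toEmbedding = (σ v).1.map f.toEmbedding := by
    rintro _ rfl
    rfl
  exact key _ (f.symm_apply_apply v)

/-- Renaming the players does not change the network. -/
def mapProfileIso (f : V ≃ W) (σ : Profile V) : network σ ≃g network (mapProfile f σ) where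
  toEquiv := f
  map_rel_iff' := by
    intro v w
    simp [network, mapProfile_apply]

theorem edist_mapProfile (f : V ≃ W) (σ : Profile V) (v w : V) :
    (network (mapProfile f σ)).edist (f v) (f w) = (network σ).edist v w := by
  have key : ∀ {A B : Type} {G : SimpleGraph A} {H : SimpleGraph B} (g : G ≃g H) (a b : A),
      H.edist (g a) (g b) ≤ G.edist a b := by
    intro A B G H g a b
    refine le_iInf fun p => ?_
    simpa using SimpleGraph.edist_le (p.map g.toHom)
  refine le_antisymm (key (mapProfileIso f σ) v w) ?_
  have := key (mapProfileIso f σ).symm (f v) (f w)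
  rwa [show (mapProfileIso f σ).symm (f v) = v from f.symm_apply_apply v,
    show (mapProfileIso f σ).symm (f w) = w from f.symm_apply_apply w] at this

theorem robust_mapProfile {f : V ≃ W} {σ : Profile V} {α : ℝ} {k : ℕ} {u : V}
    (h : Robust α k σ u) : Robust α k (mapProfile f σ) (f u) := by
  intro S
  let S' : {S : Finset V // u ∉ S} := ⟨S.1.map f.symm.toEmbedding, by
    intro hu
    obtain ⟨w, hw, hwu⟩ := Finset.mem_map.1 hu
    have : w = f u := (f.symm_apply_eq).1 hwu
    exact S.2 (this ▸ hw)⟩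
  obtain ⟨x, N, hx, hN, hc⟩ := h S'
  have hdev : deviate (mapProfile f σ) (f u) S = mapProfile f (deviate σ u S') := by
    funext w
    obtain ⟨v, rfl⟩ := f.surjective w
    apply Subtype.ext
    by_cases hv : v = u
    · subst hv
      rw [deviate_self, mapProfile_apply, deviate_self]
      ext y
      simp [S']
    · rw [deviate_of_ne _ _ _ (fun h => hv (f.injective h)), mapProfile_apply, mapProfile_apply,
        deviate_of_ne σ u S' hv]
  refine ⟨f x, N, by rw [edist_mapProfile, hx], by rwa [hdev, edist_mapProfile], ?_⟩
  simpa [mapProfile_apply, S'] using hc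

/-- Only the eccentricities are counted in the social cost; edge prices are discarded. -/
theorem exists_profile_fin [Fintype V] {n : ℕ} (hn : Fintype.card V = n) {σ : Profile V} {α : ℝ}
    (hα : 0 ≤ α) {k : ℕ} (hk : 1 ≤ k) (hσ : (network σ).Connected) (h : ∀ u, Robust α k σ u)
    {D : ℕ} (hD : ∀ u, (D : ℕ∞) ≤ (network σ).eccent u) :
    ∃ τ : Profile (Fin n), ((network τ).Connected ∧ IsLKE α k τ) ∧
      (n : ℝ≥0∞) * D ≤ socialCost α τ := by
  let f : V ≃ Fin n := Fintype.equivFinOfCardEq hn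
  have hconn : (network (mapProfile f σ)).Connected := (mapProfileIso f σ).connected_iff.1 hσ
  refine ⟨mapProfile f σ, ⟨hconn, isLKE_of_robust hα hk hconn fun w => ?_⟩, ?_⟩
  · obtain ⟨u, rfl⟩ := f.surjective w
    exact robust_mapProfile (h u)
  · have hge : ∀ w ∈ (Finset.univ : Finset (Fin n)), (D : ℝ≥0∞) ≤ cost α (mapProfile f σ) w := by
      intro w _
      obtain ⟨u, rfl⟩ := f.surjective w
      have h1 : (D : ℕ∞) ≤ (network (mapProfile f σ)).eccent (f u) := by
        refine (hD u).trans ?_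
        rw [SimpleGraph.eccent_le_iff]
        intro v
        rw [← edist_mapProfile f σ u v]
        exact SimpleGraph.edist_le_eccent
      have h2 : ((D : ℕ∞) : ℝ≥0∞) ≤ ((network (mapProfile f σ)).eccent (f u) : ℝ≥0∞) := by
        exact_mod_cast h1
      rw [ENat.toENNReal_coe] at h2
      exact h2.trans le_add_self
    have := Finset.card_nsmul_le_sum Finset.univ (fun w => cost α (mapProfile f σ) w) D hge
    simpa [socialCost] using this

end Transfer

/-! ### An upper bound on the optimum -/

section Star

/-- Everybody else buys the edge to player `0`. -/
def starProfile (m : ℕ) : Profile (Fin (m + 1)) :=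
  fun u => ⟨if u = 0 then ∅ else {0}, by
    split_ifs with h
    · simp
    · simpa using h⟩

theorem socialCost_star_le (m : ℕ) {α : ℝ} (hα : 1 < α) :
    socialCost α (starProfile m) ≤ ENNReal.ofReal (3 * (m + 1 : ℕ) * α) := by
  have h0 : ∀ v, (network (starProfile m)).edist 0 v ≤ ((1 : ℕ) : ℕ∞) := by
    intro v
    by_cases hv : v = 0
    · simp [hv]
    · refine edist_le_one_of_adj (Or.inr ?_)
      simp [starProfile, hv]
  have hcost : ∀ u ∈ (Finset.univ : Finset (Fin (m + 1))),
      cost α (starProfile m) u ≤ ENNReal.ofReal (3 * α) := by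
    intro u _
    have hcard : (starProfile m u).1.card ≤ 1 := by
      simp only [starProfile]
      split_ifs <;> simp
    have hecc : (network (starProfile m)).eccent u ≤ ((2 : ℕ) : ℕ∞) := by
      rw [SimpleGraph.eccent_le_iff]
      intro v
      have h1 := h0 u
      rw [SimpleGraph.edist_comm] at h1
      exact edist_triangle_le h1 (h0 v)
    have hecc' : ((network (starProfile m)).eccent u : ℝ≥0∞) ≤ ENNReal.ofReal 2 := by
      have : ((network (starProfile m)).eccent u : ℝ≥0∞) ≤ (((2 : ℕ) : ℕ∞) : ℝ≥0∞) := by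
        exact_mod_cast hecc
      rw [ENat.toENNReal_coe] at this
      simpa using this
    have hcard' : ((starProfile m u).1.card : ℝ≥0∞) ≤ 1 := by exact_mod_cast hcard
    calc cost α (starProfile m) u ≤ ENNReal.ofReal α * 1 + ENNReal.ofReal 2 :=
          add_le_add (mul_le_mul_right hcard' _) hecc'
      _ = ENNReal.ofReal (α + 2) := by
          rw [mul_one, ENNReal.ofReal_add (by linarith) (by norm_num)]
      _ ≤ ENNReal.ofReal (3 * α) := ENNReal.ofReal_le_ofReal (by linarith)
  refine (Finset.sum_le_card_nsmul _ _ _ hcost).trans ?_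
  rw [Finset.card_univ, Fintype.card_fin, nsmul_eq_mul, ← ENNReal.ofReal_natCast,
    ← ENNReal.ofReal_mul (by positivity)]
  exact ENNReal.ofReal_le_ofReal (by linarith)

end Star

/-! ### Connectivity, size and eccentricities of the torus -/

namespace Node

variable {d : ℕ} {δ : Fin d → ℕ} {l r : ℕ}

theorem reachable_even_shift (hl : 2 ≤ l) (a : ∀ i, ZMod (δ i)) (f : Fin d → Bool) :
    (network (profile δ l r)).Reachable (even a) (odd (shift a f)) := by
  have := edist_along_le (r := r) hl a f 0 l (by omega)
  rw [zero_add, along_zero, along_last hl] at this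
  exact SimpleGraph.reachable_of_edist_ne_top (ne_top_of_le_ne_top (ENat.natCast_ne_top _) this)

variable [∀ i, NeZero (δ i)]

/-- The translations of labels that preserve reachability form a submonoid. It contains the unit
vectors, since `odd b` is joined both to `even b` and to its translate by one in a single
coordinate. -/
theorem connected (hl : 2 ≤ l) : (network (profile δ l r)).Connected := by
  classical
  let G := network (profile δ l r)
  let H : AddSubmonoid (∀ i, ZMod (δ i)) :=
    { carrier := {a | ∀ b, G.Reachable (even b) (even (b + a))}
      zero_mem' := fun b => by rw [add_zero]
      add_mem' := fun {a a'} ha ha' b => by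
        rw [← add_assoc]
        exact (ha b).trans (ha' (b + a)) }
  have hodd : ∀ b : ∀ i, ZMod (δ i), G.Reachable (even b) (odd b) := by
    intro b
    have := reachable_even_shift (r := r) hl b fun _ => true
    have hs : shift b (fun _ => true) = b := by
      funext i
      simp [shift]
    rwa [hs] at this
  have hsingle : ∀ i, Pi.single i (1 : ZMod (δ i)) ∈ H := by
    intro i b
    refine (hodd b).trans (SimpleGraph.Reachable.symm ?_)
    have := reachable_even_shift (r := r) hl (b + Pi.single i (1 : ZMod (δ i)))
      (Function.update (fun _ => true) i false)
    have hs : shift (b + Pi.single i (1 : ZMod (δ i)))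
        (Function.update (fun _ => true) i false) = b := by
      funext j
      by_cases hj : j = i
      · subst hj
        simp [shift]
      · simp [shift, hj]
    rwa [hs] at this
  have htop : ∀ a, a ∈ H := by
    intro a
    rw [← Finset.univ_sum_single a]
    refine H.sum_mem fun i _ => ?_
    have := H.nsmul_mem (hsingle i) (a i).val
    rwa [← Pi.single_smul, nsmul_one, ZMod.natCast_zmod_val] at this
  have hall : ∀ v : Node δ l r, G.Reachable (even 0) v := by
    have heven : ∀ a : ∀ i, ZMod (δ i), G.Reachable (even 0) (even a) := by
      intro a
      have := htop a 0
      rwa [zero_add] at this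
    intro v
    rcases v with a | b | ⟨a, f, t⟩ | j
    · exact heven a
    · exact (heven b).trans (hodd b)
    · refine (heven a).trans ?_
      have := edist_along_le (r := r) hl a f 0 (t.1 + 1) (by omega)
      rw [zero_add, along_zero, along_inner] at this
      exact SimpleGraph.reachable_of_edist_ne_top
        (ne_top_of_le_ne_top (ENat.natCast_ne_top _) this)
    · exact ((heven 0).trans (hodd 0)).trans (adj_leaf j).symm.reachable
  have : Nonempty (Node δ l r) := ⟨even 0⟩
  exact ⟨fun v w => (hall v).symm.trans (hall w)⟩

/-- The nodes as a sum type. -/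
def equivSum : Node δ l r ≃ ((∀ i, ZMod (δ i)) ⊕ (∀ i, ZMod (δ i))) ⊕
    (((∀ i, ZMod (δ i)) × (Fin d → Bool) × Fin (l - 1)) ⊕ Fin r) where
  toFun
    | even a => Sum.inl (Sum.inl a)
    | odd b => Sum.inl (Sum.inr b)
    | inner a f t => Sum.inr (Sum.inl (a, f, t))
    | leaf i => Sum.inr (Sum.inr i)
  invFun
    | Sum.inl (Sum.inl a) => even a
    | Sum.inl (Sum.inr b) => odd b
    | Sum.inr (Sum.inl (a, f, t)) => inner a f t
    | Sum.inr (Sum.inr i) => leaf i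
  left_inv := by rintro (_ | _ | _ | _) <;> rfl
  right_inv := by rintro ((_ | _) | (_ | _)) <;> rfl

instance : Fintype (Node δ l r) := Fintype.ofEquiv _ equivSum.symm

theorem card_node : Fintype.card (Node δ l r) =
    (∏ i, δ i) * (2 + 2 ^ d * (l - 1)) + r := by
  rw [Fintype.card_congr equivSum]
  simp [ZMod.card]
  ring

/-- Two antipodal even intersections are `2 * l * (δ i / 2)` apart, so every node is at least half
of that from one of them. -/
theorem le_eccent (hl : 2 ≤ l) (i : Fin d) (u : Node δ l r) :
    ((l * (δ i / 2) : ℕ) : ℕ∞) ≤ (network (profile δ l r)).eccent u := by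
  classical
  by_contra h
  rw [not_le] at h
  have hne : (network (profile δ l r)).eccent u ≠ ⊤ := h.ne_top
  obtain ⟨m, hm⟩ := ENat.ne_top_iff_exists.1 hne
  rw [← hm] at h
  have hlt : m < l * (δ i / 2) := by exact_mod_cast h
  have hd : ∀ v, (network (profile δ l r)).edist u v ≤ m := by
    intro v
    rw [hm]
    exact SimpleGraph.edist_le_eccent
  let b : ∀ i, ZMod (δ i) := Pi.single i ((δ i / 2 : ℕ) : ZMod (δ i))
  have h1 := hd (even b)
  rw [SimpleGraph.edist_comm] at h1
  have h2 := edist_triangle_le h1 (hd (even 0))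
  have h3 : ((2 * l * (δ i / 2) : ℕ) : ℕ∞) ≤
      (network (profile δ l r)).edist (even b) (even 0) := by
    refine le_edist_of_coord_intCast hl _ _ i _ (2 * l * (δ i / 2 : ℕ)) ?_ ?_ ?_
    · simp only [coord, Pi.zero_apply, map_zero, sub_zero, b, Pi.single_eq_same]
      rw [← Int.cast_natCast, stretch_intCast]
    · rw [abs_of_nonneg (by positivity)]
      push_cast
      exact le_rfl
    · rw [abs_of_nonneg (by positivity)]
      have : 2 * (δ i / 2) ≤ δ i := Nat.mul_div_le _ _
      have : 2 * l * (2 * (δ i / 2)) ≤ 2 * l * δ i := Nat.mul_le_mul_left _ this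
      have h4 : 2 * l * (δ i / 2) + 2 * l * (δ i / 2) ≤ 2 * l * δ i := by linarith
      exact_mod_cast h4
  have h4 : 2 * l * (δ i / 2) ≤ m + m := by exact_mod_cast h3.trans h2
  have : 2 * l * (δ i / 2) = 2 * (l * (δ i / 2)) := by ring
  omega

end Node

/-! ### Estimates for the parameters -/

section Numerics

theorem logb_one_add_two_div_le {q : ℝ} (hq : 1 ≤ q) :
    Real.logb 2 (1 + 2 / q) ≤ 8 / 5 := by
  have h1 : 1 + 2 / q ≤ 3 := by
    have : 2 / q ≤ 2 := div_le_self (by norm_num) hq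
    linarith
  have h2 : Real.logb 2 (1 + 2 / q) ≤ Real.logb 2 3 :=
    Real.logb_le_logb_of_le (by norm_num) (by positivity) h1
  refine h2.trans ?_
  rw [Real.logb, div_le_iff₀ (Real.log_pos (by norm_num))]
  have h3 : Real.log ((3 : ℝ) ^ 5) ≤ Real.log ((2 : ℝ) ^ 8) :=
    Real.log_le_log (by norm_num) (by norm_num)
  rw [Real.log_pow, Real.log_pow] at h3
  push_cast at h3
  linarith

theorem logb_one_add_two_div_mul_logb_le {q : ℝ} (hq : 1 ≤ q) :
    Real.logb 2 (1 + 2 / q) * Real.logb 2 q ≤ 5 := by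
  have hq0 : 0 < q := by linarith
  have h2 : (0.69 : ℝ) ≤ Real.log 2 := by
    have := Real.log_two_gt_d9
    linarith
  have h1 : Real.log (1 + 2 / q) ≤ 2 / q := by
    have := Real.log_le_sub_one_of_pos (show 0 < 1 + 2 / q by positivity)
    linarith
  have h3 : Real.log q ≤ q := by
    have := Real.log_le_sub_one_of_pos hq0
    linarith
  have h4 : Real.log (1 + 2 / q) * Real.log q ≤ 2 := by
    calc Real.log (1 + 2 / q) * Real.log q ≤ 2 / q * q :=
          mul_le_mul h1 h3 (Real.log_nonneg hq) (by positivity)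
      _ = 2 := div_mul_cancel₀ _ hq0.ne'
  rw [Real.logb, Real.logb, div_mul_div_comm, div_le_iff₀ (by positivity)]
  nlinarith

/-- With `x = log Δ ≤ 1 + L + b`, the first product is at most `2 ^ (x² + x + 1)`. The correction `b
= log (1 + 2 / q)` decays fast enough that `b * L` stays bounded, so the exponent exceeds `(L + 3) *
L` only by a constant. -/
theorem pow_clog_mul_le {q : ℝ} (hq : 1 ≤ q) {Δ : ℕ} (hΔ : 2 ≤ Δ) (hΔq : (Δ : ℝ) ≤ 2 * (q + 2)) :
    ((Δ : ℝ) ^ (Nat.clog 2 Δ - 1) * 2 ^ Nat.clog 2 Δ ≤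
      2 ^ 23 * (2 : ℝ) ^ ((Real.logb 2 q + 3) * Real.logb 2 q)) ∧
    ((Δ : ℝ) ^ (Nat.clog 2 Δ - 1) * 2 ^ Nat.clog 2 Δ * Δ ≤
      (2 : ℝ) ^ ((Real.logb 2 q + 18 / 5) ^ 2)) := by
  have hq0 : 0 < q := by linarith
  have hΔ0 : (0 : ℝ) < Δ := by exact_mod_cast (by omega : 0 < Δ)
  have hd : 1 ≤ Nat.clog 2 Δ := Nat.clog_pos (by norm_num) hΔ
  have hlt : 2 ^ (Nat.clog 2 Δ - 1) < Δ := Nat.pow_pred_clog_lt_self (by norm_num) hΔ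
  obtain ⟨m, hm⟩ : ∃ m, Nat.clog 2 Δ = m + 1 := ⟨Nat.clog 2 Δ - 1, by omega⟩
  rw [hm] at hlt ⊢
  simp only [Nat.add_sub_cancel] at hlt ⊢
  have hlt' : (2 : ℝ) ^ m ≤ Δ := by exact_mod_cast hlt.le
  set x := Real.logb 2 Δ with hx
  set L := Real.logb 2 q with hL
  set b := Real.logb 2 (1 + 2 / q) with hb
  have hΔx : (Δ : ℝ) = (2 : ℝ) ^ x := (Real.rpow_logb (by norm_num) (by norm_num) hΔ0).symm
  have hmx : (m : ℝ) ≤ x := by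
    rw [hx, Real.le_logb_iff_rpow_le (by norm_num) hΔ0, Real.rpow_natCast]
    exact hlt'
  have hxL : x ≤ 1 + L + b := by
    have h1 : x ≤ Real.logb 2 (2 * (q * (1 + 2 / q))) := by
      refine Real.logb_le_logb_of_le (by norm_num) hΔ0 (hΔq.trans (le_of_eq ?_))
      field_simp
    rw [Real.logb_mul (by norm_num) (by positivity), Real.logb_mul (by positivity) (by positivity),
      Real.logb_self_eq_one (by norm_num)] at h1
    linarith
  have hx0 : 0 ≤ x := (Nat.cast_nonneg m).trans hmx
  have hL0 : 0 ≤ L := Real.logb_nonneg (by norm_num) hq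
  have hb1 : b ≤ 8 / 5 := logb_one_add_two_div_le hq
  have hb0 : 0 ≤ b := Real.logb_nonneg (by norm_num) (by
    have : 0 ≤ 2 / q := by positivity
    linarith)
  have hbL : b * L ≤ 5 := logb_one_add_two_div_mul_logb_le hq
  have hmain : (Δ : ℝ) ^ m * 2 ^ (m + 1) ≤ (2 : ℝ) ^ (x ^ 2 + x + 1) := by
    have h1 : (Δ : ℝ) ^ m ≤ (2 : ℝ) ^ (x ^ 2) := by
      rw [hΔx, ← Real.rpow_natCast, ← Real.rpow_mul (by norm_num)]
      exact Real.rpow_le_rpow_of_exponent_le (by norm_num) (by nlinarith)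
    have h2 : (2 : ℝ) ^ (m + 1) ≤ (2 : ℝ) ^ (x + 1) := by
      rw [← Real.rpow_natCast]
      exact Real.rpow_le_rpow_of_exponent_le (by norm_num) (by push_cast; linarith)
    rw [add_assoc, Real.rpow_add (by norm_num)]
    exact mul_le_mul h1 h2 (by positivity) (by positivity)
  have hsq : x ^ 2 ≤ (1 + L + b) ^ 2 := pow_le_pow_left₀ hx0 hxL 2
  constructor
  · refine hmain.trans ?_
    rw [← Real.rpow_natCast 2 23, ← Real.rpow_add (by norm_num)]
    -- The excess is `2bL + (1 + b)² + b + 2`, below `23` by `b * L ≤ 5` and `b ≤ 8 / 5`.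
    refine Real.rpow_le_rpow_of_exponent_le (by norm_num) ?_
    push_cast
    nlinarith
  · calc (Δ : ℝ) ^ m * 2 ^ (m + 1) * Δ ≤ (2 : ℝ) ^ (x ^ 2 + x + 1) * (2 : ℝ) ^ x :=
          mul_le_mul hmain hΔx.le hΔ0.le (by positivity)
      _ = (2 : ℝ) ^ ((x + 1) ^ 2) := by
          rw [← Real.rpow_add (by norm_num)]
          congr 1
          ring
      _ ≤ _ := by
          refine Real.rpow_le_rpow_of_exponent_le (by norm_num) ?_
          exact pow_le_pow_left₀ (by linarith) (by linarith) 2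

/-- The number of players is large enough for the construction. -/
theorem le_of_le_two_rpow_sqrt {n k l : ℕ} (hl : 2 ≤ l) (hlk : l ≤ k)
    (hk : (k : ℝ) ≤ (2 : ℝ) ^ (Real.sqrt (Real.logb 2 (n : ℝ)) - 3)) :
    (2 : ℝ) ^ ((Real.logb 2 ((k : ℝ) / l) + 18 / 5) ^ 2) * l ≤ n := by
  have hl0 : (0 : ℝ) < l := by exact_mod_cast (by omega : 0 < l)
  have hk0 : (0 : ℝ) < k := by exact_mod_cast (by omega : 0 < k)
  have hq : 1 ≤ (k : ℝ) / l := by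
    rw [one_le_div hl0]
    exact_mod_cast hlk
  set L := Real.logb 2 ((k : ℝ) / l) with hL
  set c := Real.logb 2 (l : ℝ) with hc
  have hL0 : 0 ≤ L := Real.logb_nonneg (by norm_num) hq
  have hc1 : 1 ≤ c := by
    rw [hc, Real.le_logb_iff_rpow_le (by norm_num) hl0, Real.rpow_one]
    exact_mod_cast hl
  have hlog : Real.logb 2 (k : ℝ) = L + c := by
    rw [hL, hc, ← Real.logb_mul (by positivity) (by positivity), div_mul_cancel₀ _ hl0.ne']
  have h1 : L + c + 3 ≤ Real.sqrt (Real.logb 2 (n : ℝ)) := by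
    have := (Real.logb_le_iff_le_rpow (by norm_num) hk0).2 hk
    linarith
  rw [Real.le_sqrt' (by linarith)] at h1
  have hn0 : (0 : ℝ) < n := by
    rcases Nat.eq_zero_or_pos n with rfl | h
    · rw [Nat.cast_zero, Real.logb_zero] at h1
      nlinarith
    · exact_mod_cast h
  have hlc : (l : ℝ) = (2 : ℝ) ^ c := (Real.rpow_logb (by norm_num) (by norm_num) hl0).symm
  -- Since `c ≥ 1`, the square `(L + c + 3)²` exceeds `(L + 18 / 5)²` by more than `c`.
  calc (2 : ℝ) ^ ((L + 18 / 5) ^ 2) * l = (2 : ℝ) ^ ((L + 18 / 5) ^ 2 + c) := by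
        rw [Real.rpow_add (by norm_num), ← hlc]
    _ ≤ (2 : ℝ) ^ (Real.logb 2 (n : ℝ)) :=
        Real.rpow_le_rpow_of_exponent_le (by norm_num) (by nlinarith)
    _ = n := Real.rpow_logb (by norm_num) (by norm_num) hn0

end Numerics

/-! ### Choice of the parameters and conclusion -/

/-- An equilibrium on `n` players in which every player is far from somebody. -/
theorem exists_equilibrium {n k l : ℕ} {α : ℝ} (hl : 2 ≤ l) (hlk : l ≤ k) (hα : 1 < α)
    (hαl : α ≤ l) (hlα : (l : ℝ) ≤ α + 1)
    (hn : (2 : ℝ) ^ ((Real.logb 2 ((k : ℝ) / l) + 18 / 5) ^ 2) * l ≤ n) :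
    ∃ (D : ℕ) (τ : Profile (Fin n)), ((network τ).Connected ∧ IsLKE α k τ) ∧
      (n : ℝ≥0∞) * D ≤ socialCost α τ ∧
      (n : ℝ) ≤ 6 * 2 ^ 23 * (2 : ℝ) ^ ((Real.logb 2 ((k : ℝ) / l) + 3) *
        Real.logb 2 ((k : ℝ) / l)) * D := by
  have hl0 : (0 : ℝ) < l := by exact_mod_cast (by omega : 0 < l)
  have hq : 1 ≤ (k : ℝ) / l := by
    rw [one_le_div hl0]
    exact_mod_cast hlk
  set q := (k : ℝ) / l with hqdef
  have hkq : (k : ℝ) = l * q := by rw [hqdef, mul_div_cancel₀ _ hl0.ne']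
  set m := ⌈q⌉₊ with hm
  have hmq : q ≤ m := Nat.le_ceil q
  have hmq' : (m : ℝ) ≤ q + 1 := (Nat.ceil_lt_add_one (by linarith)).le
  have hm1 : 1 ≤ m := by exact_mod_cast hq.trans hmq
  have hkm : k ≤ l * m := by
    have : (k : ℝ) ≤ l * m := by
      rw [hkq]
      exact mul_le_mul_of_nonneg_left hmq hl0.le
    exact_mod_cast this
  -- The side `2m + 2` yields the period `2lΔ ≥ 4k + 4l`, and `2 ^ d ≥ 2m + 2` yields enough corners
  -- for `hcard`.
  obtain ⟨h1, h2⟩ := pow_clog_mul_le hq (Δ := 2 * m + 2) (by omega) (by push_cast; linarith)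
  have hΔd : 2 * m + 2 ≤ 2 ^ Nat.clog 2 (2 * m + 2) := Nat.le_pow_clog (by norm_num) _
  generalize Nat.clog 2 (2 * m + 2) = d at h1 h2 hΔd
  generalize hΔ : 2 * m + 2 = Δ at h1 h2 hΔd
  have hd2 : 2 ≤ d := by
    by_contra hlt
    have : 2 ^ d ≤ 2 ^ 1 := Nat.pow_le_pow_right (by norm_num) (by omega)
    omega
  -- The number of nodes per unit of the long side; that side becomes `n / w`, and the remainder `n
  -- % w` becomes leaves.
  set w := Δ ^ (d - 1) * (2 + 2 ^ d * (l - 1)) with hw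
  have hw0 : 0 < w := by
    have : 0 < Δ := by omega
    positivity
  have hwle : w ≤ Δ ^ (d - 1) * 2 ^ d * l := by
    rw [hw, mul_assoc]
    refine Nat.mul_le_mul_left _ ?_
    obtain ⟨p, rfl⟩ : ∃ p, l = p + 1 := ⟨l - 1, by omega⟩
    rw [Nat.add_sub_cancel, mul_add]
    omega
  have hwle' : (w : ℝ) ≤ (Δ : ℝ) ^ (d - 1) * 2 ^ d * l := by exact_mod_cast hwle
  have hwn : w * Δ ≤ n := by
    have : (w : ℝ) * Δ ≤ n := by
      refine le_trans ?_ hn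
      calc (w : ℝ) * Δ ≤ (Δ : ℝ) ^ (d - 1) * 2 ^ d * l * Δ :=
            mul_le_mul_of_nonneg_right hwle' (Nat.cast_nonneg _)
        _ = (Δ : ℝ) ^ (d - 1) * 2 ^ d * Δ * l := by ring
        _ ≤ _ := mul_le_mul_of_nonneg_right h2 hl0.le
    exact_mod_cast this
  set M := n / w with hM
  have hΔM : Δ ≤ M := (Nat.le_div_iff_mul_le hw0).2 (by linarith)
  let i₀ : Fin d := ⟨0, by omega⟩
  let i₁ : Fin d := ⟨1, by omega⟩
  have hi : i₁ ≠ i₀ := by simp [i₀, i₁]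
  let δ : Fin d → ℕ := Function.update (fun _ => Δ) i₀ M
  have hδ : ∀ i, Δ ≤ δ i := by
    intro i
    by_cases h : i = i₀
    · simpa [δ, h] using hΔM
    · simp [δ, h]
  have : ∀ i, NeZero (δ i) := fun i => ⟨by have := hδ i; omega⟩
  have hP : ∀ i, 4 * k + 4 * l ≤ 2 * l * δ i := by
    intro i
    have : 2 * l * Δ ≤ 2 * l * δ i := Nat.mul_le_mul_left _ (hδ i)
    rw [← hΔ] at this
    nlinarith
  have hcard : (k : ℝ) ≤ α * (2 ^ d - 2) + 1 := by
    have h3 : (2 * m : ℝ) ≤ 2 ^ d - 2 := by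
      have : ((2 * m + 2 : ℕ) : ℝ) ≤ ((2 ^ d : ℕ) : ℝ) := by exact_mod_cast hΔ ▸ hΔd
      push_cast at this
      linarith
    have h4 : (k : ℝ) ≤ l * m := by exact_mod_cast hkm
    have h5 : (l : ℝ) * m ≤ 2 * α * m :=
      mul_le_mul_of_nonneg_right (by linarith) (Nat.cast_nonneg _)
    have h6 : α * (2 * m) ≤ α * (2 ^ d - 2) := mul_le_mul_of_nonneg_left h3 (by linarith)
    linarith
  have hprod : ∏ i, δ i = M * Δ ^ (d - 1) := by
    rw [Finset.prod_update_of_mem (Finset.mem_univ i₀), Finset.prod_const,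
      Finset.card_sdiff_of_subset (Finset.subset_univ _), Finset.card_univ, Fintype.card_fin,
      Finset.card_singleton]
  have hcardn : Fintype.card (Node δ l (n % w)) = n := by
    rw [Node.card_node, hprod, mul_assoc, ← hw, hM, mul_comm, Nat.div_add_mod]
  obtain ⟨τ, hτ, hcost⟩ := exists_profile_fin hcardn (by linarith : 0 ≤ α) (by omega : 1 ≤ k)
    (Node.connected hl)
    (fun u => show Robust α k (Node.profile δ l (n % w)) u from by
      rcases u with a | b | ⟨a, f, t⟩ | y
      · exact Node.robust_even hl hlk hα hlα hcard hP i₀ a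
      · exact Node.robust_odd hl hlk hα hlα hcard hP i₀ b
      · by_cases ht : t.1 = 0
        · exact Node.robust_inner_zero hl hlk hα hαl hlα hcard hP i₀ i₁ hi a f t ht
        · exact Node.robust_inner_of_pos hl hlk hα hαl hlα hcard hP i₀ a f t ht
      · exact Node.robust_leaf hl hlk hα hlα hcard hP i₀ y)
    (Node.le_eccent hl i₀)
  refine ⟨_, τ, hτ, hcost, ?_⟩
  have hδi : δ i₀ = M := by simp [δ]
  rw [hδi]
  have hM2 : M ≤ 3 * (M / 2) := by omega
  -- The factor `6` absorbs both roundings: `n < w * (M + 1)` and `M + 1 ≤ 6 * (M / 2)`.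
  have hn1 : n ≤ 6 * (w * (M / 2)) := by
    have h3 := Nat.div_add_mod n w
    have h4 := Nat.mod_lt n hw0
    rw [← hM] at h3
    have h5 : w * (M + 1) ≤ w * (6 * (M / 2)) := Nat.mul_le_mul_left _ (by omega)
    rw [mul_add] at h5
    linarith
  calc (n : ℝ) ≤ 6 * (w * (M / 2 : ℕ)) := by exact_mod_cast hn1
    _ ≤ 6 * ((Δ : ℝ) ^ (d - 1) * 2 ^ d * l * (M / 2 : ℕ)) := by gcongr
    _ ≤ 6 * (2 ^ 23 * (2 : ℝ) ^ ((Real.logb 2 q + 3) * Real.logb 2 q) * l * (M / 2 : ℕ)) := by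
        gcongr
    _ = _ := by
        push_cast
        ring

end MaxNCG

end

theorem mainTheorem1 :
    ∃ c : ℝ, 0 < c ∧
      ∀ (n k : ℕ) (α : ℝ), 1 < α → α ≤ (k : ℝ) →
        (k : ℝ) ≤ (2 : ℝ) ^ (Real.sqrt (Real.logb 2 (n : ℝ)) - 3) →
        ENNReal.ofReal (c * ((n : ℝ) / (α * (2 : ℝ) ^
          ((Real.logb 2 ((k : ℝ) / (⌈α⌉₊ : ℝ)) + 3) * Real.logb 2 ((k : ℝ) / (⌈α⌉₊ : ℝ))))))
          ≤ MaxNCG.priceOfAnarchy n α k := by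
  -- The factor `3` of the star times the factor `6 * 2 ^ 23` of the equilibrium.
  refine ⟨1 / (18 * 2 ^ 23), by positivity, fun n k α hα hαk hk => ?_⟩
  have hl : 2 ≤ ⌈α⌉₊ := by
    have h1 : 1 < ⌈α⌉₊ := Nat.lt_ceil.2 (by exact_mod_cast hα)
    omega
  have hlk : ⌈α⌉₊ ≤ k := Nat.ceil_le.2 hαk
  have hn := MaxNCG.le_of_le_two_rpow_sqrt hl hlk hk
  obtain ⟨D, τ, hτ, hcost, hD⟩ := MaxNCG.exists_equilibrium hl hlk hα (Nat.le_ceil α)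
    (Nat.ceil_lt_add_one (by linarith)).le hn
  have hn0 : (0 : ℝ) < n := by
    refine lt_of_lt_of_le ?_ hn
    have : (0 : ℝ) < ⌈α⌉₊ := by exact_mod_cast (by omega : 0 < ⌈α⌉₊)
    positivity
  generalize (2 : ℝ) ^ ((Real.logb 2 ((k : ℝ) / (⌈α⌉₊ : ℝ)) + 3) *
    Real.logb 2 ((k : ℝ) / (⌈α⌉₊ : ℝ))) = E at hD ⊢
  have hE : 0 < E := by
    by_contra hle
    have : E * D ≤ 0 := mul_nonpos_of_nonpos_of_nonneg (not_lt.1 hle) (Nat.cast_nonneg D)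
    nlinarith
  have hreal : 1 / (18 * 2 ^ 23) * ((n : ℝ) / (α * E)) ≤ (n * D) / (3 * n * α) := by
    rw [div_mul_div_comm, div_le_div_iff₀ (by positivity) (by positivity)]
    have : 0 ≤ 3 * n * α := by positivity
    nlinarith [mul_le_mul_of_nonneg_left hD this]
  refine (ENNReal.ofReal_le_ofReal hreal).trans ?_
  rw [ENNReal.ofReal_div_of_pos (by positivity)]
  refine ENNReal.div_le_div ?_ ?_
  · rw [ENNReal.ofReal_mul (by positivity), ENNReal.ofReal_natCast, ENNReal.ofReal_natCast]
    exact hcost.trans (le_iSup₂_of_le (f := fun (σ : MaxNCG.Profile (Fin n))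
      (_ : (MaxNCG.network σ).Connected ∧ MaxNCG.IsLKE α k σ) => MaxNCG.socialCost α σ)
      τ hτ le_rfl)
  · obtain ⟨m, rfl⟩ : ∃ m, n = m + 1 := ⟨n - 1, by
      have : 0 < n := by exact_mod_cast hn0
      omega⟩
    exact (iInf_le _ (MaxNCG.starProfile m)).trans (MaxNCG.socialCost_star_le m hα)
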